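/- Let $M=\mathbb T^d=\mathbb R^d/\mathbb Z^d$ and let $\mathcal P=\{\rho\in C^\infty(M):\rho>0,\ \int\rho\,dx=1\}$, with tangent spaces $T_\rho\mathcal P=\{\sigma\in C^\infty(M):\int\sigma\,dx=0\}$. For $a\in C^\infty(M)$ write $\Delta_a=\nabla\cdot(a\nabla)$; for $\sigma\in T_\rho\mathcal P$ let $\Delta_\rho^{-1}\sigma$ be the mean-zero smooth solution $\Phi$ of $\nabla\cdot(\rho\nabla\Phi)=\sigma$. The transport (Wasserstein-2) metric is $g(\rho)(\sigma_1,\sigma_2)=\int\sigma_1(-\Delta_\rho)^{-1}\sigma_2\,dx$, with Christoffel symbol $$\Gamma(\rho)(\sigma_1,\sigma_2)=-\tfrac12\big\{\Delta_{\sigma_1}\Delta_\rho^{-1}\sigma_2+\Delta_{\sigma_2}\Delta_\rho^{-1}\sigma_1+\Delta_\rho(\nabla\Delta_\rho^{-1}\sigma_1,\nabla\Delta_\rho^{-1}\sigma_2)\big\}.$$ Let $\mathcal E:\mathcal P\to\mathbb R$ be a smooth energy. This means that $\mathcal E$ has at every $\rho\in\mathcal P$ an $L^2$ first variation $\delta\mathcal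 E(\rho)\in C^\infty(M)$, i.e. $\frac{d}{d\varepsilon}\big|_{\varepsilon=0}\mathcal E(\rho+\varepsilon\sigma)=\int\delta\mathcal E(\rho)\,\sigma\,dx$ for all $\sigma\in T_\rho\mathcal P$, normalised by $\int\delta\mathcal E(\rho)\,dx=0$, and that both $\mathcal E$ and $\delta\mathcal E:\mathcal P\to C^\infty(M)$ are smooth, in the sense that they take families of densities depending smoothly on finitely many real parameters to smooth families. Write $\delta^2\mathcal E(\rho)(\sigma_1,\sigma_2)=\partial_a\partial_b\,\mathcal E(\rho+a\sigma_1+b\sigma_2)\big|_{a=b=0}$ for the second variation. The transport Hessian metric is $$g^H(\rho)(\sigma_1,\sigma_2)=\mathrm{Hess}_g\mathcal E(\rho)(\sigma_1,\sigma_2)=\delta^2\mathcal E(\rho)(\sigma_1,\sigma_2)-\int\delta\mathcal E(\rho)\,\Gamma(\rho)(\sigma_1,\sigma_2)\,dx ,$$ and it is assumed that $g^H(\rho)(\sigma,\sigma)>0$ for all $\rho\in\mathcal P$ and all $0\ne\sigma\in T_\rho\mathcal P$. For a metric $G\in\{g,g^H\}$ and a functional $\mathcal G$ on $\mathcal P$,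 a gradient $\mathrm{grad}_G\mathcal G(\rho)$ is an element $v\in T_\rho\mathcal P$ such that $\mathcal G$ has an $L^2$ first variation $\delta\mathcal G(\rho)\in C^\infty(M)$ and $G(\rho)(\sigma,v)=\int\delta\mathcal G(\rho)\,\sigma\,dx$ for all $\sigma\in T_\rho\mathcal P$. A gradient flow of $\mathcal G$ in $(\mathcal P,G)$ over a set of times $I\subseteq\mathbb R$ (for instance an interval) is a path $(\rho_t)_{t\in I}$ in $\mathcal P$ with $\partial_t\rho_t(x)=-\mathrm{grad}_G\mathcal G(\rho_t)(x)$ for all $t\in I$ and $x\in M$, the time derivative being taken within $I$. Consider the energy $$\mathcal F(\rho)=\frac12\int\|\nabla\delta\mathcal E(\rho)(x)\|^2\rho(x)\,dx .$$ **Corollary (Transport gradient flow).** For every $\rho\in\mathcal P$ the gradients $\mathrm{grad}_{g^H}\mathcal F(\rho)$ and $\mathrm{grad}_g\mathcal E(\rho)$ exist and are unique, and $$\mathrm{grad}_{g^H}\mathcal F(\rho)=\mathrm{grad}_g\mathcal E(\rho)=-\nabla\cdot(\rho\nabla\delta\mathcal E(\rho)).$$ Consequently, for every path $(\rho_t)_{t\in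 I}$ in $\mathcal P$ the following are equivalent: (i) it is a gradient flow of $\mathcal F$ in $(\mathcal P,g^H)$; (ii) it satisfies $\partial_t\rho_t=\nabla\cdot(\rho_t\nabla\delta\mathcal E(\rho_t))$; (iii) it is a gradient flow of $\mathcal E$ in $(\mathcal P,g)$. -/

import Mathlib

open scoped ContDiff

noncomputable section

namespace TransportHessian

/-- The flat torus `ℝ^d / ℤ^d`, with its normalised Lebesgue (Haar) measure `volume`. -/
abbrev Torus (d : ℕ) : Type := UnitAddTorus (Fin d)

/-- The projection `ℝ^d → ℝ^d / ℤ^d`. -/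
def proj {d : ℕ} (y : Fin d → ℝ) : Torus d := fun i => (y i : UnitAddCircle)

/-- `f ∈ C^∞(𝕋^d)`. -/
def IsSmooth {d : ℕ} (f : Torus d → ℝ) : Prop :=
  ContDiff ℝ ∞ (fun y : Fin d → ℝ => f (proj y))

/-- A family `r s` of functions on the torus, indexed by `s ∈ U ⊆ ℝ^n`, with
`(s, x) ↦ r s x` of class `C^∞` on `U × 𝕋^d`. -/
def IsSmoothFamily {d n : ℕ} (U : Set (Fin n → ℝ)) (r : (Fin n → ℝ) → Torus d → ℝ) : Prop :=
  ContDiffOn ℝ ∞ (fun p : (Fin n → ℝ) × (Fin d → ℝ) => r p.1 (proj p.2)) (U ×ˢ Set.univ)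

/-- The partial derivative `∂f/∂x_i` on the torus. -/
def pderiv {d : ℕ} (i : Fin d) (f : Torus d → ℝ) (x : Torus d) : ℝ :=
  deriv (fun s : ℝ => f (x + Pi.single i (s : UnitAddCircle))) 0

/-- `(∇f(x), ∇h(x))`, the Euclidean inner product of the gradients. -/
def gradInner {d : ℕ} (f h : Torus d → ℝ) (x : Torus d) : ℝ :=
  ∑ i : Fin d, pderiv i f x * pderiv i h x

/-- The weighted Laplacian `Δ_a f = ∇·(a ∇f)`. -/
def weightedLaplacian {d : ℕ} (a f : Torus d → ℝ) (x : Torus d) : ℝ :=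
  ∑ i : Fin d, pderiv i (fun y => a y * pderiv i f y) x

/-- `ρ ∈ 𝒫`: smooth, positive, of total mass one. -/
structure IsDensity {d : ℕ} (ρ : Torus d → ℝ) : Prop where
  smooth : IsSmooth ρ
  pos : ∀ x, 0 < ρ x
  mass : ∫ x, ρ x = 1

/-- `σ ∈ T_ρ 𝒫`: smooth of mean zero (the condition does not depend on `ρ`). -/
structure IsTangent {d : ℕ} (σ : Torus d → ℝ) : Prop where
  smooth : IsSmooth σ
  mean_zero : ∫ x, σ x = 0

/-- `φ` is an `L²` first variation at `ρ` of the functional `E`. Functionals on `𝒫` are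
represented by functions on all of `Torus d → ℝ`; only their values on `𝒫` matter, because
`ρ + ε σ ∈ 𝒫` for small `ε`. -/
def IsFirstVariation {d : ℕ} (E : (Torus d → ℝ) → ℝ) (ρ φ : Torus d → ℝ) : Prop :=
  IsSmooth φ ∧ ∀ σ : Torus d → ℝ, IsTangent σ →
    HasDerivAt (fun ε : ℝ => E (ρ + ε • σ)) (∫ x, φ x * σ x) 0

open Classical in
/-- The `L²` first variation `δE(ρ)`. It is unique up to an additive constant, which is fixed
by mean zero; the value is `0` when there is none. -/
def firstVariation {d : ℕ} (E : (Torus d → ℝ) → ℝ) (ρ : Torus d → ℝ) : Torus d → ℝ :=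
  if h : ∃ φ : Torus d → ℝ, IsFirstVariation E ρ φ ∧ ∫ x, φ x = 0 then h.choose else 0

/-- The second variation as a bilinear form, `∫∫ δ²E(ρ)(x, y) σ₁(x) σ₂(y) dx dy`, where
`δ²E(ρ)` may be a distributional kernel: the mixed second derivative of `E` along `σ₁, σ₂`. -/
def secondVariation {d : ℕ} (E : (Torus d → ℝ) → ℝ) (ρ σ₁ σ₂ : Torus d → ℝ) : ℝ :=
  deriv (fun a : ℝ => deriv (fun b : ℝ => E (ρ + a • σ₁ + b • σ₂)) 0) 0

/-- `E : 𝒫 → ℝ` is a smooth energy: `E` is smooth, has an `L²` first variation everywhere,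
and `δE : 𝒫 → C^∞(𝕋^d)` is smooth. A map on `𝒫` is smooth when it takes smooth
finite-parameter families in `𝒫` to smooth families. -/
structure IsSmoothEnergy {d : ℕ} (E : (Torus d → ℝ) → ℝ) : Prop where
  smooth : ∀ (n : ℕ) (U : Set (Fin n → ℝ)) (r : (Fin n → ℝ) → Torus d → ℝ),
    IsOpen U → IsSmoothFamily U r → (∀ s ∈ U, IsDensity (r s)) →
      ContDiffOn ℝ ∞ (fun s => E (r s)) U
  exists_firstVariation : ∀ ρ : Torus d → ℝ, IsDensity ρ → ∃ φ, IsFirstVariation E ρ φ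
  smooth_firstVariation : ∀ (n : ℕ) (U : Set (Fin n → ℝ)) (r : (Fin n → ℝ) → Torus d → ℝ),
    IsOpen U → IsSmoothFamily U r → (∀ s ∈ U, IsDensity (r s)) →
      IsSmoothFamily U (fun s => firstVariation E (r s))

open Classical in
/-- `Δ_ρ⁻¹ σ`: the smooth mean-zero solution `Φ` of `∇·(ρ ∇Φ) = σ`. -/
def invWeightedLaplacian {d : ℕ} (ρ σ : Torus d → ℝ) : Torus d → ℝ :=
  if h : ∃ Φ : Torus d → ℝ, IsSmooth Φ ∧ ∫ x, Φ x = 0 ∧ weightedLaplacian ρ Φ = σ then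
    h.choose else 0

/-- The transport (Wasserstein-2) metric `g(ρ)(σ₁, σ₂) = ∫ σ₁ (-Δ_ρ)⁻¹ σ₂ dx`. -/
def transportMetric {d : ℕ} (ρ σ₁ σ₂ : Torus d → ℝ) : ℝ :=
  ∫ x, σ₁ x * (-invWeightedLaplacian ρ σ₂ x)

/-- The Christoffel symbol of the transport metric,
`Γ(ρ)(σ₁, σ₂) = -½ {Δ_{σ₁} Δ_ρ⁻¹ σ₂ + Δ_{σ₂} Δ_ρ⁻¹ σ₁ + Δ_ρ (∇Δ_ρ⁻¹ σ₁, ∇Δ_ρ⁻¹ σ₂)}`. -/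
def christoffel {d : ℕ} (ρ σ₁ σ₂ : Torus d → ℝ) (x : Torus d) : ℝ :=
  -(1 / 2) * (weightedLaplacian σ₁ (invWeightedLaplacian ρ σ₂) x
    + weightedLaplacian σ₂ (invWeightedLaplacian ρ σ₁) x
    + weightedLaplacian ρ
        (gradInner (invWeightedLaplacian ρ σ₁) (invWeightedLaplacian ρ σ₂)) x)

/-- The transport Hessian metric `g^H = Hess_g E`,
`g^H(ρ)(σ₁, σ₂) = ∫∫ δ²E(ρ) σ₁ σ₂ dx dy - ∫ δE(ρ) Γ(ρ)(σ₁, σ₂) dx`. -/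
def hessianMetric {d : ℕ} (E : (Torus d → ℝ) → ℝ) (ρ σ₁ σ₂ : Torus d → ℝ) : ℝ :=
  secondVariation E ρ σ₁ σ₂ - ∫ x, firstVariation E ρ x * christoffel ρ σ₁ σ₂ x

/-- `v` is the gradient of `F` at `ρ` for the metric `G`: `v ∈ T_ρ 𝒫`, the first variation
of `F` at `ρ` exists, and `G(ρ)(σ, v) = ∫ δF(ρ) σ dx` for all `σ ∈ T_ρ 𝒫`. -/
def IsGradient {d : ℕ} (G : (Torus d → ℝ) → (Torus d → ℝ) → (Torus d → ℝ) → ℝ)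
    (F : (Torus d → ℝ) → ℝ) (ρ v : Torus d → ℝ) : Prop :=
  IsTangent v ∧ (∃ φ, IsFirstVariation F ρ φ) ∧
    ∀ σ : Torus d → ℝ, IsTangent σ → G ρ σ v = ∫ x, firstVariation F ρ x * σ x

/-- `ρ` is a gradient flow of `F` in `(𝒫, G)` over the set of times `I`: a path in `𝒫` with
`∂_t ρ = -grad_G F(ρ)` (one-sided derivative at an end point of `I`). -/
def IsGradientFlow {d : ℕ} (G : (Torus d → ℝ) → (Torus d → ℝ) → (Torus d → ℝ) → ℝ)
    (F : (Torus d → ℝ) → ℝ) (I : Set ℝ) (ρ : ℝ → Torus d → ℝ) : Prop :=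
  (∀ t ∈ I, IsDensity (ρ t)) ∧
    ∀ t ∈ I, ∃ v : Torus d → ℝ, IsGradient G F (ρ t) v ∧
      ∀ x, HasDerivWithinAt (fun s => ρ s x) (-v x) I t

/-- `F(ρ) = ½ ∫ ‖∇δE(ρ)‖² ρ dx`. -/
def gradientEnergy {d : ℕ} (E : (Torus d → ℝ) → ℝ) (ρ : Torus d → ℝ) : ℝ :=
  (1 / 2) * ∫ x, gradInner (firstVariation E ρ) (firstVariation E ρ) x * ρ x

/-- `ρ` is a path in `𝒫` over the set of times `I` solving `∂_t ρ = ∇·(ρ ∇δE(ρ))`. -/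
def SolvesTransportEquation {d : ℕ} (E : (Torus d → ℝ) → ℝ) (I : Set ℝ)
    (ρ : ℝ → Torus d → ℝ) : Prop :=
  (∀ t ∈ I, IsDensity (ρ t)) ∧
    ∀ t ∈ I, ∀ x, HasDerivWithinAt (fun s => ρ s x)
      (weightedLaplacian (ρ t) (firstVariation E (ρ t)) x) I t

end TransportHessian

end

/-! Write `e = δE(ρ)` and `v = -∇·(ρ∇e)`. Since `e` has mean zero, `Δ_ρ⁻¹ v = -e`, so `v` is the
`g`-gradient of `E` and `F(ρ) = ½ g(v, v)`. In Riemannian terms `dF(σ) = Hess E(σ, grad E)`, which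
says that `v` is also the `g^H`-gradient of `F`. Concretely, differentiating `F` along `σ` gives `∫
ρ (∇e, ∇ψ) + ½ ∫ ‖∇e‖² σ`, with `ψ` the derivative of `δE` along `σ`. Green's identity turns the
first term into `δ²E(σ, v)`. In `∫ e Γ(σ, v)` two of the three terms cancel and `-½ ∫ ‖∇e‖² σ` is
left (`integral_mul_christoffel`); the sum is `g^H(σ, v)` (`hessianMetric_transportGrad`). Symmetry
of `δ²E` makes `dF` an integral against a smooth function. Positivity of `g^H` gives uniqueness of
the gradient of `F`; for `g`, testing with `Δ_ρ⁻¹ w + e` identifies any gradient `w`. The analytic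
input is that `Δ_ρ` is invertible on smooth mean-zero functions (`exists_weightedLaplacian_eq`). The
substitution `u = √ρ Φ` turns `Δ_ρ Φ = σ` into a Schrödinger equation whose kernel is spanned by
`√ρ`; adding the rank one term `(∫ u) √ρ` makes it injective. On Fourier coefficients in `ℓ¹` the
equation is a compact perturbation of the identity, so the Fredholm alternative solves it, and a
bootstrap on the decay of the coefficients gives smoothness. -/

noncomputable section

namespace TransportHessian

open Set Filter Topology MeasureTheory

/-! ### Differential calculus and integration by parts on the torus. -/

section Calculus

variable {d : ℕ} {F : Type*} [NormedAddCommGroup F] [NormedSpace ℝ F]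

lemma isOpenQuotientMap_proj : IsOpenQuotientMap (proj : (Fin d → ℝ) → Torus d) :=
  IsOpenQuotientMap.piMap (fun _ => QuotientAddGroup.isOpenQuotientMap_mk)

lemma surjective_proj : Function.Surjective (proj : (Fin d → ℝ) → Torus d) :=
  isOpenQuotientMap_proj.surjective

lemma proj_add (y z : Fin d → ℝ) : proj (y + z) = proj y + proj z := by
  ext i; simp [proj]

lemma proj_single (i : Fin d) (s : ℝ) :
    proj (Pi.single i s) = Pi.single i (s : UnitAddCircle) := by
  funext j
  by_cases h : j = i
  · subst h; simp [proj]
  · simp [proj, h]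

/-- Every point of the torus lifts to the unit cube. -/
lemma exists_proj_mem_cube (x : Torus d) :
    ∃ y ∈ Set.Icc (0 : Fin d → ℝ) 1, proj y = x := by
  have h : ∀ i, ∃ t ∈ Set.Ico (0 : ℝ) (0 + 1), (t : UnitAddCircle) = x i := fun i =>
    ⟨_, (AddCircle.equivIco 1 0 (x i)).2, (AddCircle.equivIco 1 0).symm_apply_apply (x i)⟩
  choose y hy hyx using h
  refine ⟨y, ⟨fun i => (hy i).1, fun i => ?_⟩, funext hyx⟩
  simpa using (hy i).2.le

/-- `f ∈ C^∞(𝕋^d, F)`. -/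
def Smooth (f : Torus d → F) : Prop := ContDiff ℝ ∞ (fun y : Fin d → ℝ => f (proj y))

/-- The partial derivative of a vector-valued function on the torus. -/
def tderiv (i : Fin d) (f : Torus d → F) (x : Torus d) : F :=
  deriv (fun s : ℝ => f (x + Pi.single i (s : UnitAddCircle))) 0

lemma pderiv_eq (i : Fin d) (f : Torus d → ℝ) : pderiv i f = tderiv i f := rfl

lemma hasDerivAt_line {f : Torus d → F} {y : Fin d → ℝ} {i : Fin d} {L : (Fin d → ℝ) →L[ℝ] F}
    (h : HasFDerivAt (fun y : Fin d → ℝ => f (proj y)) L y) :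
    HasDerivAt (fun s : ℝ => f (proj y + Pi.single i (s : UnitAddCircle)))
      (L (Pi.single i 1)) 0 := by
  have h1 : HasDerivAt (fun s : ℝ => y + s • (Pi.single i 1 : Fin d → ℝ)) (Pi.single i 1) 0 := by
    simpa using ((hasDerivAt_id (0 : ℝ)).smul_const (Pi.single i 1 : Fin d → ℝ)).const_add y
  have h2 := HasFDerivAt.comp_hasDerivAt (0 : ℝ) (by simpa using h) h1
  convert! h2 using 1
  funext s
  simp only [Function.comp, proj_add, ← Pi.single_smul, smul_eq_mul, mul_one, proj_single]

/-- The bridge to calculus on `ℝ^d`: regularity of torus derivatives is read off from the Fréchet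
derivative of the periodic lift. -/
lemma tderiv_proj {f : Torus d → F} {y : Fin d → ℝ} (i : Fin d)
    (h : DifferentiableAt ℝ (fun y : Fin d → ℝ => f (proj y)) y) :
    tderiv i f (proj y) = fderiv ℝ (fun y : Fin d → ℝ => f (proj y)) y (Pi.single i 1) :=
  (hasDerivAt_line h.hasFDerivAt).deriv

namespace Smooth

lemma differentiable {f : Torus d → F} (hf : Smooth f) :
    Differentiable ℝ (fun y : Fin d → ℝ => f (proj y)) :=
  ContDiff.differentiable hf (by simp)

lemma continuous {f : Torus d → F} (hf : Smooth f) : Continuous f :=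
  isOpenQuotientMap_proj.isQuotientMap.continuous_iff.2 (ContDiff.continuous hf)

lemma hasDerivAt {f : Torus d → F} (hf : Smooth f) (i : Fin d) (x : Torus d) :
    HasDerivAt (fun s : ℝ => f (x + Pi.single i (s : UnitAddCircle))) (tderiv i f x) 0 := by
  obtain ⟨y, rfl⟩ := surjective_proj x
  rw [tderiv_proj i (hf.differentiable y)]
  exact hasDerivAt_line (hf.differentiable y).hasFDerivAt

protected lemma tderiv {f : Torus d → F} (hf : Smooth f) (i : Fin d) : Smooth (tderiv i f) := by
  have h : (fun y : Fin d → ℝ => tderiv i f (proj y)) =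
      fun y => fderiv ℝ (fun y : Fin d → ℝ => f (proj y)) y (Pi.single i 1) :=
    funext fun y => tderiv_proj i (hf.differentiable y)
  unfold Smooth
  rw [h]
  exact (ContDiff.fderiv_right (m := ∞) hf (by simp)).clm_apply contDiff_const

lemma integrable {f : Torus d → F} (hf : Smooth f) : Integrable f :=
  hf.continuous.integrable_of_hasCompactSupport (HasCompactSupport.of_compactSpace f)

lemma add {f g : Torus d → F} (hf : Smooth f) (hg : Smooth g) : Smooth (f + g) :=
  ContDiff.add hf hg

lemma sub {f g : Torus d → F} (hf : Smooth f) (hg : Smooth g) : Smooth (f - g) :=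
  ContDiff.sub hf hg

lemma neg {f : Torus d → F} (hf : Smooth f) : Smooth (-f) := ContDiff.neg hf

lemma const (c : F) : Smooth (fun _ : Torus d => c) := contDiff_const

lemma mul {A : Type*} [NormedRing A] [NormedAlgebra ℝ A] {f g : Torus d → A}
    (hf : Smooth f) (hg : Smooth g) : Smooth (f * g) :=
  ContDiff.mul hf hg

lemma const_smul {f : Torus d → F} (hf : Smooth f) (c : ℝ) : Smooth (c • f) :=
  ContDiff.const_smul c hf

lemma sum {ι : Type*} {s : Finset ι} {f : ι → Torus d → F} (hf : ∀ i ∈ s, Smooth (f i)) :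
    Smooth (fun x => ∑ i ∈ s, f i x) :=
  ContDiff.sum hf

lemma clm {G : Type*} [NormedAddCommGroup G] [NormedSpace ℝ G] {f : Torus d → F}
    (hf : Smooth f) (L : F →L[ℝ] G) : Smooth (fun x => L (f x)) :=
  L.contDiff.comp hf

lemma div {f g : Torus d → ℝ} (hf : Smooth f) (hg : Smooth g) (h : ∀ x, g x ≠ 0) :
    Smooth (f / g) :=
  ContDiff.div hf hg fun _ => h _

lemma sqrt {f : Torus d → ℝ} (hf : Smooth f) (h : ∀ x, 0 < f x) :
    Smooth (fun x => Real.sqrt (f x)) :=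
  ContDiff.sqrt hf fun _ => (h _).ne'

end Smooth

lemma tderiv_add {f g : Torus d → F} (hf : Smooth f) (hg : Smooth g) (i : Fin d) :
    tderiv i (f + g) = tderiv i f + tderiv i g :=
  funext fun x => ((hf.hasDerivAt i x).add (hg.hasDerivAt i x)).deriv

lemma tderiv_sub {f g : Torus d → F} (hf : Smooth f) (hg : Smooth g) (i : Fin d) :
    tderiv i (f - g) = tderiv i f - tderiv i g :=
  funext fun x => ((hf.hasDerivAt i x).sub (hg.hasDerivAt i x)).deriv

lemma tderiv_neg {f : Torus d → F} (hf : Smooth f) (i : Fin d) :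
    tderiv i (-f) = -tderiv i f :=
  funext fun x => (hf.hasDerivAt i x).neg.deriv

lemma tderiv_const (c : F) (i : Fin d) : tderiv i (fun _ : Torus d => c) = 0 :=
  funext fun x => by simp [tderiv]

lemma tderiv_const_smul {f : Torus d → F} (hf : Smooth f) (c : ℝ) (i : Fin d) :
    tderiv i (c • f) = c • tderiv i f :=
  funext fun x => ((hf.hasDerivAt i x).const_smul c).deriv

lemma tderiv_mul {A : Type*} [NormedRing A] [NormedAlgebra ℝ A] {f g : Torus d → A}
    (hf : Smooth f) (hg : Smooth g) (i : Fin d) :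
    tderiv i (f * g) = tderiv i f * g + f * tderiv i g :=
  funext fun x => by
    have := ((hf.hasDerivAt i x).mul (hg.hasDerivAt i x)).deriv
    simp only [QuotientAddGroup.mk_zero, Pi.single_zero, add_zero] at this
    exact this

lemma tderiv_clm {G : Type*} [NormedAddCommGroup G] [NormedSpace ℝ G] {f : Torus d → F}
    (hf : Smooth f) (L : F →L[ℝ] G) (i : Fin d) :
    tderiv i (fun x => L (f x)) = fun x => L (tderiv i f x) :=
  funext fun x => (L.hasFDerivAt.comp_hasDerivAt (0 : ℝ) (hf.hasDerivAt i x)).deriv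

/-- A one-parameter family of functions on the torus, jointly smooth over `U × 𝕋^d`. -/
def SmoothFam (U : Set ℝ) (G : ℝ → Torus d → F) : Prop :=
  ContDiffOn ℝ ∞ (fun p : ℝ × (Fin d → ℝ) => G p.1 (proj p.2)) (U ×ˢ Set.univ)

/-- The derivative of a family in the parameter. -/
def paramDeriv (G : ℝ → Torus d → F) (ε : ℝ) (x : Torus d) : F := deriv (fun e => G e x) ε

namespace SmoothFam

variable {U : Set ℝ} {G : ℝ → Torus d → F}

lemma differentiableAt (hG : SmoothFam U G) (hU : IsOpen U) {ε : ℝ} (hε : ε ∈ U)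
    (y : Fin d → ℝ) :
    DifferentiableAt ℝ (fun p : ℝ × (Fin d → ℝ) => G p.1 (proj p.2)) (ε, y) :=
  (ContDiffOn.contDiffAt hG ((hU.prod isOpen_univ).mem_nhds ⟨hε, trivial⟩)).differentiableAt
    (by simp)

lemma slice (hG : SmoothFam U G) {ε : ℝ} (hε : ε ∈ U) : Smooth (G ε) :=
  contDiffOn_univ.1 (ContDiffOn.comp hG (f := fun y : Fin d → ℝ => (ε, y)) (s := univ)
    (by fun_prop) fun _ _ => ⟨hε, trivial⟩)

lemma hasDerivAt_proj (hG : SmoothFam U G) (hU : IsOpen U) {ε : ℝ} (hε : ε ∈ U)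
    (y : Fin d → ℝ) : HasDerivAt (fun e => G e (proj y))
      (fderiv ℝ (fun p : ℝ × (Fin d → ℝ) => G p.1 (proj p.2)) (ε, y) (1, 0)) ε := by
  have h1 : HasDerivAt (fun e : ℝ => (e, y)) ((1 : ℝ), (0 : Fin d → ℝ)) ε :=
    (hasDerivAt_id ε).prodMk (hasDerivAt_const ε y)
  exact (hG.differentiableAt hU hε y).hasFDerivAt.comp_hasDerivAt ε h1

lemma hasDerivAt (hG : SmoothFam U G) (hU : IsOpen U) {ε : ℝ} (hε : ε ∈ U) (x : Torus d) :
    HasDerivAt (fun e => G e x) (paramDeriv G ε x) ε := by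
  obtain ⟨y, rfl⟩ := surjective_proj x
  exact (hG.hasDerivAt_proj hU hε y).differentiableAt.hasDerivAt

/-- Parameter and space derivatives are the cases `v = (1, 0)` and `v = (0, e_i)`, so both preserve
smooth families. -/
lemma fderiv_apply (hG : SmoothFam U G) (hU : IsOpen U) (v : ℝ × (Fin d → ℝ)) :
    ContDiffOn ℝ ∞ (fun q => fderiv ℝ (fun p : ℝ × (Fin d → ℝ) => G p.1 (proj p.2)) q v)
      (U ×ˢ Set.univ) :=
  (ContDiffOn.fderiv_of_isOpen hG (hU.prod isOpen_univ) (m := ∞) (by simp)).clm_apply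
    contDiffOn_const

protected lemma paramDeriv (hG : SmoothFam U G) (hU : IsOpen U) : SmoothFam U (paramDeriv G) :=
  (hG.fderiv_apply hU (1, 0)).congr fun p hp => (hG.hasDerivAt_proj hU hp.1 p.2).deriv

lemma tderiv_eq (hG : SmoothFam U G) (hU : IsOpen U) {ε : ℝ} (hε : ε ∈ U) (i : Fin d)
    (y : Fin d → ℝ) : tderiv i (G ε) (proj y) =
      fderiv ℝ (fun p : ℝ × (Fin d → ℝ) => G p.1 (proj p.2)) (ε, y) (0, Pi.single i 1) := by
  rw [tderiv_proj i ((hG.slice hε).differentiable y)]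
  have h1 : HasFDerivAt (fun z : Fin d → ℝ => (ε, z))
      (ContinuousLinearMap.inr ℝ ℝ (Fin d → ℝ)) y := hasFDerivAt_prodMk_right ε y
  have := ((hG.differentiableAt hU hε y).hasFDerivAt.comp y h1).fderiv
  refine (congrArg (fun L => L (Pi.single i 1)) this).trans ?_
  rw [ContinuousLinearMap.comp_apply, ContinuousLinearMap.inr_apply]

protected lemma tderiv (hG : SmoothFam U G) (hU : IsOpen U) (i : Fin d) :
    SmoothFam U (fun ε => tderiv i (G ε)) :=
  (hG.fderiv_apply hU (0, Pi.single i 1)).congr fun p hp => hG.tderiv_eq hU hp.1 i p.2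

/-- The derivatives in the parameter and in the space variable commute. -/
lemma paramDeriv_tderiv (hG : SmoothFam U G) (hU : IsOpen U) {ε : ℝ} (hε : ε ∈ U) (i : Fin d) :
    paramDeriv (fun e => tderiv i (G e)) ε =
      tderiv i (paramDeriv G ε) := by
  funext x
  obtain ⟨y, rfl⟩ := surjective_proj x
  set H := fun p : ℝ × (Fin d → ℝ) => G p.1 (proj p.2) with hH
  have hO : U ×ˢ (univ : Set (Fin d → ℝ)) ∈ 𝓝 (ε, y) :=
    (hU.prod isOpen_univ).mem_nhds ⟨hε, trivial⟩
  have hc : ContDiffAt ℝ ∞ H (ε, y) := ContDiffOn.contDiffAt hG hO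
  have hd : DifferentiableAt ℝ (fderiv ℝ H) (ε, y) :=
    (hc.fderiv_right (m := 1) (by norm_cast)).differentiableAt (by simp)
  have key : ∀ v w : ℝ × (Fin d → ℝ),
      fderiv ℝ (fun q => fderiv ℝ H q v) (ε, y) w = fderiv ℝ (fderiv ℝ H) (ε, y) w v := by
    intro v w
    rw [fderiv_clm_apply hd (differentiableAt_const v)]
    simp
  have hs := hc.isSymmSndFDerivAt
    (by simpa using (WithTop.coe_le_coe.2 le_top : ((2 : ℕ∞) : WithTop ℕ∞) ≤ ∞))
  rw [show paramDeriv (fun e => tderiv i (G e)) ε (proj y) = _ from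
    ((hG.tderiv hU i).hasDerivAt_proj hU hε y).deriv, (hG.paramDeriv hU).tderiv_eq hU hε,
    Filter.EventuallyEq.fderiv_eq (f₁ := fun p : ℝ × (Fin d → ℝ) =>
        tderiv i (G p.1) (proj p.2)) (f := fun q => fderiv ℝ H q (0, Pi.single i 1))
      (Filter.mem_of_superset hO fun p hp => hG.tderiv_eq hU hp.1 i p.2),
    Filter.EventuallyEq.fderiv_eq (f₁ := fun p : ℝ × (Fin d → ℝ) =>
        paramDeriv G p.1 (proj p.2)) (f := fun q => fderiv ℝ H q (1, 0))
      (Filter.mem_of_superset hO fun p hp => (hG.hasDerivAt_proj hU hp.1 p.2).deriv), key, key]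
  -- Both sides are now the second derivative of `H` on `(1, 0)` and `(0, e_i)`, in opposite orders.
  exact hs _ _

lemma of_smooth {f : Torus d → F} (hf : Smooth f) : SmoothFam U (fun _ => f) :=
  (ContDiff.comp hf contDiff_snd).contDiffOn

lemma add {G' : ℝ → Torus d → F} (hG : SmoothFam U G) (hG' : SmoothFam U G') :
    SmoothFam U (fun ε => G ε + G' ε) := ContDiffOn.add hG hG'

lemma mul {A : Type*} [NormedRing A] [NormedAlgebra ℝ A] {G G' : ℝ → Torus d → A}
    (hG : SmoothFam U G) (hG' : SmoothFam U G') :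
    SmoothFam U (fun ε => G ε * G' ε) := ContDiffOn.mul hG hG'

lemma sum {ι : Type*} {s : Finset ι} {G : ι → ℝ → Torus d → F}
    (hG : ∀ i ∈ s, SmoothFam U (G i)) : SmoothFam U (fun ε x => ∑ i ∈ s, G i ε x) :=
  ContDiffOn.sum hG

/-- Differentiation under the integral sign. -/
lemma hasDerivAt_integral [CompleteSpace F] (hG : SmoothFam U G) (hU : IsOpen U) {ε : ℝ}
    (hε : ε ∈ U) :
    HasDerivAt (fun e => ∫ x, G e x) (∫ x, paramDeriv G ε x) ε := by
  obtain ⟨δ, hδ, hball⟩ := Metric.isOpen_iff.1 hU ε hε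
  have hsub : Metric.closedBall ε (δ / 2) ⊆ U :=
    (Metric.closedBall_subset_ball (by linarith)).trans hball
  -- The unit cube meets every fibre of `proj`, so a bound over this compact set bounds the
  -- derivative on the whole torus.
  have hK : IsCompact (Metric.closedBall ε (δ / 2) ×ˢ Set.Icc (0 : Fin d → ℝ) 1) :=
    (isCompact_closedBall _ _).prod isCompact_Icc
  obtain ⟨C, hC⟩ := hK.exists_bound_of_continuousOn
    ((ContDiffOn.continuousOn (hG.paramDeriv hU)).mono (Set.prod_mono hsub (subset_univ _)))
  refine (hasDerivAt_integral_of_dominated_loc_of_deriv_le (bound := fun _ => C)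
    (F' := paramDeriv G)
    (Metric.ball_mem_nhds ε (half_pos hδ)) ?_ (hG.slice hε).integrable
    ((hG.paramDeriv hU).slice hε).continuous.aestronglyMeasurable ?_ (integrable_const C) ?_).2
  · filter_upwards [hU.mem_nhds hε] with e he
    exact (hG.slice he).continuous.aestronglyMeasurable
  · refine Filter.Eventually.of_forall fun x e he => ?_
    obtain ⟨y, hy, rfl⟩ := exists_proj_mem_cube x
    exact hC (e, y) ⟨Metric.ball_subset_closedBall he, hy⟩
  · exact Filter.Eventually.of_forall fun x e he =>
      hG.hasDerivAt hU (hsub (Metric.ball_subset_closedBall he)) x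

end SmoothFam

/-- By translation invariance `s ↦ ∫ f(x + s e_i) dx` is constant; its derivative at `0` is the
integral of `∂_i f`. -/
lemma integral_tderiv [CompleteSpace F] {f : Torus d → F} (hf : Smooth f) (i : Fin d) :
    ∫ x, tderiv i f x = 0 := by
  have hG : SmoothFam univ
      (fun (s : ℝ) (x : Torus d) => f (x + Pi.single i (s : UnitAddCircle))) := by
    have h1 : ContDiff ℝ ∞ (fun p : ℝ × (Fin d → ℝ) => p.2 + Pi.single i p.1) :=
      contDiff_snd.add ((ContinuousLinearMap.contDiff
        (ContinuousLinearMap.single ℝ (fun _ : Fin d => ℝ) i)).comp contDiff_fst)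
    have : ContDiff ℝ ∞ (fun p : ℝ × (Fin d → ℝ) => f (proj (p.2 + Pi.single i p.1))) :=
      ContDiff.comp (g := fun y : Fin d → ℝ => f (proj y)) hf h1
    refine ContDiff.contDiffOn ?_
    simpa only [proj_add, proj_single] using this
  have h := hG.hasDerivAt_integral isOpen_univ (mem_univ 0)
  simp only [integral_add_right_eq_self] at h
  exact h.unique (hasDerivAt_const _ _)

end Calculus

/-! ### The weighted Laplacian: Green's identity, kernel, ground state transformation. -/

section Laplacian

variable {d : ℕ} {F : Type*} [NormedAddCommGroup F] [NormedSpace ℝ F]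

instance : IsProbabilityMeasure (volume : Measure UnitAddCircle) :=
  ⟨UnitAddCircle.measure_univ⟩

instance : IsProbabilityMeasure (volume : Measure (Torus d)) :=
  inferInstanceAs (IsProbabilityMeasure (Measure.pi fun _ : Fin d => volume))

lemma smooth_gradInner {f h : Torus d → ℝ} (hf : Smooth f) (hh : Smooth h) :
    Smooth (gradInner f h) :=
  Smooth.sum fun i _ => (hf.tderiv i).mul (hh.tderiv i)

lemma smooth_weightedLaplacian {a f : Torus d → ℝ} (ha : Smooth a) (hf : Smooth f) :
    Smooth (weightedLaplacian a f) :=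
  Smooth.sum fun i _ => (ha.mul (hf.tderiv i)).tderiv i

lemma weightedLaplacian_apply (a f : Torus d → ℝ) (x : Torus d) :
    weightedLaplacian a f x = ∑ i, tderiv i (a * tderiv i f) x := rfl

lemma weightedLaplacian_add_right {a f g : Torus d → ℝ} (ha : Smooth a) (hf : Smooth f)
    (hg : Smooth g) :
    weightedLaplacian a (f + g) = weightedLaplacian a f + weightedLaplacian a g := by
  funext x
  simp only [weightedLaplacian_apply, Pi.add_apply, ← Finset.sum_add_distrib]
  refine Finset.sum_congr rfl fun i _ => ?_
  rw [tderiv_add hf hg, mul_add, tderiv_add (ha.mul (hf.tderiv i)) (ha.mul (hg.tderiv i)),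
    Pi.add_apply]

lemma weightedLaplacian_smul_right {a f : Torus d → ℝ} (ha : Smooth a) (hf : Smooth f) (c : ℝ) :
    weightedLaplacian a (c • f) = c • weightedLaplacian a f := by
  funext x
  simp only [weightedLaplacian_apply, Pi.smul_apply, Finset.smul_sum]
  refine Finset.sum_congr rfl fun i _ => ?_
  rw [tderiv_const_smul hf, mul_smul_comm, tderiv_const_smul (ha.mul (hf.tderiv i)),
    Pi.smul_apply]

lemma weightedLaplacian_neg_right {a f : Torus d → ℝ} (ha : Smooth a) (hf : Smooth f) :
    weightedLaplacian a (-f) = -weightedLaplacian a f := by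
  simpa using weightedLaplacian_smul_right ha hf (-1)

lemma weightedLaplacian_sub_right {a f g : Torus d → ℝ} (ha : Smooth a) (hf : Smooth f)
    (hg : Smooth g) :
    weightedLaplacian a (f - g) = weightedLaplacian a f - weightedLaplacian a g := by
  rw [sub_eq_add_neg, weightedLaplacian_add_right ha hf hg.neg, weightedLaplacian_neg_right ha hg,
    sub_eq_add_neg]

lemma weightedLaplacian_sub_left {a b f : Torus d → ℝ} (ha : Smooth a) (hb : Smooth b)
    (hf : Smooth f) :
    weightedLaplacian (a - b) f = weightedLaplacian a f - weightedLaplacian b f := by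
  funext x
  simp only [weightedLaplacian_apply, Pi.sub_apply, ← Finset.sum_sub_distrib]
  refine Finset.sum_congr rfl fun i _ => ?_
  rw [sub_mul, tderiv_sub (ha.mul (hf.tderiv i)) (hb.mul (hf.tderiv i)), Pi.sub_apply]

lemma gradInner_comm (f h : Torus d → ℝ) : gradInner f h = gradInner h f := by
  funext x; simp [gradInner, mul_comm]

lemma gradInner_sub_right {f g h : Torus d → ℝ} (hg : Smooth g) (hh : Smooth h) :
    gradInner f (g - h) = gradInner f g - gradInner f h := by
  funext x
  simp only [gradInner, pderiv_eq, tderiv_sub hg hh, Pi.sub_apply, mul_sub,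
    Finset.sum_sub_distrib]

lemma gradInner_neg_right {f g : Torus d → ℝ} (hg : Smooth g) :
    gradInner f (-g) = -gradInner f g := by
  funext x
  simp only [gradInner, pderiv_eq, tderiv_neg hg, Pi.neg_apply, mul_neg, Finset.sum_neg_distrib]

/-- Green's first identity on the torus. -/
lemma integral_weightedLaplacian_mul {a f h : Torus d → ℝ} (ha : Smooth a) (hf : Smooth f)
    (hh : Smooth h) :
    ∫ x, weightedLaplacian a f x * h x = -∫ x, a x * gradInner f h x := by
  have key : ∀ i, ∫ x, tderiv i (a * tderiv i f) x * h x =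
      -∫ x, a x * (tderiv i f x * tderiv i h x) := by
    intro i
    have hs := ha.mul (hf.tderiv i)
    have h0 := integral_tderiv (hs.mul hh) i
    rw [tderiv_mul hs hh, integral_add' ((hs.tderiv i).mul hh).integrable
      (hs.mul (hh.tderiv i)).integrable] at h0
    simp only [Pi.mul_apply, mul_assoc] at h0 ⊢
    linarith
  simp only [weightedLaplacian_apply, gradInner, Finset.sum_mul, Finset.mul_sum, pderiv_eq]
  rw [integral_finsetSum (f := fun i x => tderiv i (a * tderiv i f) x * h x) _
      fun i _ => (((ha.mul (hf.tderiv i)).tderiv i).mul hh).integrable,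
    integral_finsetSum (f := fun i x => a x * (tderiv i f x * tderiv i h x)) _
      fun i _ => (ha.mul ((hf.tderiv i).mul (hh.tderiv i))).integrable,
    ← Finset.sum_neg_distrib]
  exact Finset.sum_congr rfl fun i _ => key i

lemma integral_weightedLaplacian {a f : Torus d → ℝ} (ha : Smooth a) (hf : Smooth f) :
    ∫ x, weightedLaplacian a f x = 0 := by
  simp only [weightedLaplacian_apply]
  rw [integral_finsetSum _ fun i _ => ((ha.mul (hf.tderiv i)).tderiv i).integrable]
  exact Finset.sum_eq_zero fun i _ => integral_tderiv (ha.mul (hf.tderiv i)) i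

lemma integral_weightedLaplacian_mul_comm {a f h : Torus d → ℝ} (ha : Smooth a) (hf : Smooth f)
    (hh : Smooth h) :
    ∫ x, weightedLaplacian a f x * h x = ∫ x, f x * weightedLaplacian a h x := by
  rw [integral_weightedLaplacian_mul ha hf hh, gradInner_comm,
    ← integral_weightedLaplacian_mul ha hh hf]
  simp only [mul_comm]

lemma eq_zero_of_integral_eq_zero {f : Torus d → ℝ} (hf : Continuous f) (h0 : ∀ x, 0 ≤ f x)
    (h : ∫ x, f x = 0) : f = 0 := by
  have hi : Integrable f :=
    hf.integrable_of_hasCompactSupport (HasCompactSupport.of_compactSpace f)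
  exact (Continuous.ae_eq_iff_eq volume hf continuous_const).1
    ((integral_eq_zero_iff_of_nonneg h0 hi).1 h)

lemma exists_eq_const_of_tderiv_eq_zero {f : Torus d → F} (hf : Smooth f)
    (h : ∀ i, tderiv i f = 0) : ∃ c, f = fun _ => c := by
  have h0 : ∀ y, fderiv ℝ (fun y : Fin d → ℝ => f (proj y)) y = 0 := by
    intro y
    refine ContinuousLinearMap.coe_injective (LinearMap.pi_ext' fun i => LinearMap.ext_ring ?_)
    have := tderiv_proj i (hf.differentiable y)
    rw [h i] at this
    simpa using this.symm
  refine ⟨f (proj 0), funext fun x => ?_⟩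
  obtain ⟨y, rfl⟩ := surjective_proj x
  exact is_const_of_fderiv_eq_zero hf.differentiable h0 y 0

/-- The kernel of `Δ_ρ` consists of the constants. -/
lemma exists_eq_const_of_weightedLaplacian_eq_zero {ρ f : Torus d → ℝ} (hρ : Smooth ρ)
    (hpos : ∀ x, 0 < ρ x) (hf : Smooth f) (h : weightedLaplacian ρ f = 0) :
    ∃ c, f = fun _ => c := by
  -- Testing the equation against `f` itself leaves `∫ ρ ‖∇f‖² = 0`.
  have h1 := integral_weightedLaplacian_mul hρ hf hf
  simp only [h, Pi.zero_apply, zero_mul, integral_zero] at h1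
  have hsq : ∀ x, 0 ≤ gradInner f f x := fun x =>
    Finset.sum_nonneg fun i _ => mul_self_nonneg _
  have h2 := eq_zero_of_integral_eq_zero (hρ.mul (smooth_gradInner hf hf)).continuous
    (fun x => mul_nonneg (hpos x).le (hsq x)) (by simp only [Pi.mul_apply]; linarith)
  refine exists_eq_const_of_tderiv_eq_zero hf fun i => funext fun x => ?_
  have h3 : gradInner f f x = 0 := by
    have := congrFun h2 x
    simpa [(hpos x).ne'] using this
  have h4 := (Finset.sum_eq_zero_iff_of_nonneg fun i _ => mul_self_nonneg _).1 h3 i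
    (Finset.mem_univ i)
  simpa [pderiv_eq] using h4

lemma eq_of_weightedLaplacian_eq {ρ f g : Torus d → ℝ} (hρ : Smooth ρ) (hpos : ∀ x, 0 < ρ x)
    (hf : Smooth f) (hg : Smooth g) (hf0 : ∫ x, f x = 0) (hg0 : ∫ x, g x = 0)
    (h : weightedLaplacian ρ f = weightedLaplacian ρ g) : f = g := by
  obtain ⟨c, hc⟩ := exists_eq_const_of_weightedLaplacian_eq_zero hρ hpos (hf.sub hg)
    (by rw [weightedLaplacian_sub_right hρ hf hg, h, sub_self])
  have h0 : ∫ x, (f - g) x = 0 := by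
    rw [integral_sub' hf.integrable hg.integrable, hf0, hg0, sub_zero]
  rw [hc] at h0
  have hc0 : c = 0 := by simpa using h0
  rw [← sub_eq_zero, hc, hc0]; rfl

/-- Uniqueness of mean-zero solutions identifies the chosen one; values of `Δ_ρ⁻¹` are computed by
exhibiting a solution. -/
lemma invWeightedLaplacian_eq {ρ σ Φ : Torus d → ℝ} (hρ : IsDensity ρ) (hΦ : Smooth Φ)
    (h0 : ∫ x, Φ x = 0) (h : weightedLaplacian ρ Φ = σ) : invWeightedLaplacian ρ σ = Φ := by
  have hex : ∃ Φ : Torus d → ℝ, IsSmooth Φ ∧ ∫ x, Φ x = 0 ∧ weightedLaplacian ρ Φ = σ :=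
    ⟨Φ, hΦ, h0, h⟩
  rw [invWeightedLaplacian, dif_pos hex]
  obtain ⟨h1, h2, h3⟩ := hex.choose_spec
  exact eq_of_weightedLaplacian_eq hρ.smooth hρ.pos h1 hΦ h2 h0 (h3.trans h.symm)

/-- The flat Laplacian of a vector-valued function. -/
def laplacian (f : Torus d → F) (x : Torus d) : F := ∑ i, tderiv i (tderiv i f) x

lemma smooth_laplacian {f : Torus d → F} (hf : Smooth f) : Smooth (laplacian f) :=
  Smooth.sum fun i _ => (hf.tderiv i).tderiv i

lemma laplacian_clm {G : Type*} [NormedAddCommGroup G] [NormedSpace ℝ G] {f : Torus d → F}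
    (hf : Smooth f) (L : F →L[ℝ] G) :
    laplacian (fun x => L (f x)) = fun x => L (laplacian f x) := by
  funext x
  simp only [laplacian, map_sum]
  exact Finset.sum_congr rfl fun i _ => by
    rw [tderiv_clm hf L, tderiv_clm (hf.tderiv i) L]

/-- The ground state transformation: `Δ_{s²} Φ = s Δ(s Φ) - s Φ Δ s`. -/
lemma weightedLaplacian_sq {s Φ : Torus d → ℝ} (hs : Smooth s) (hΦ : Smooth Φ) :
    weightedLaplacian (s * s) Φ = s * laplacian (s * Φ) - s * Φ * laplacian s := by
  funext x
  simp only [weightedLaplacian_apply, laplacian, Pi.sub_apply, Pi.mul_apply, Finset.mul_sum,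
    ← Finset.sum_sub_distrib]
  refine Finset.sum_congr rfl fun i _ => ?_
  rw [tderiv_mul (hs.mul hs) (hΦ.tderiv i), tderiv_mul hs hs, tderiv_mul hs hΦ,
    tderiv_add ((hs.tderiv i).mul hΦ) (hs.mul (hΦ.tderiv i)), tderiv_mul (hs.tderiv i) hΦ,
    tderiv_mul hs (hΦ.tderiv i)]
  simp only [Pi.add_apply, Pi.mul_apply]
  ring

end Laplacian

/-! ### Fourier series with rapidly decreasing coefficients. -/

section Fourier

open UnitAddTorus

variable {d : ℕ}

/-- The weight `1 + ‖k‖` on the frequencies. -/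
def wt (k : Fin d → ℤ) : ℝ := 1 + ‖k‖

lemma one_le_wt (k : Fin d → ℤ) : 1 ≤ wt k := by simp [wt]

lemma wt_pos (k : Fin d → ℤ) : 0 < wt k := one_pos.trans_le (one_le_wt k)

/-- Submultiplicativity of the weight is what makes every weighted `ℓ¹` space stable under
convolution. -/
lemma wt_add_le (k l : Fin d → ℤ) : wt (k + l) ≤ wt k * wt l := by
  have := norm_add_le k l
  have := mul_nonneg (norm_nonneg k) (norm_nonneg l)
  simp only [wt]; nlinarith

lemma abs_le_wt (k : Fin d → ℤ) (i : Fin d) : |(k i : ℝ)| ≤ wt k := by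
  have := norm_le_pi_norm k i
  rw [Int.norm_eq_abs] at this
  simp only [wt]; linarith

lemma summable_prod_pi {g : ℤ → ℝ} (h0 : ∀ n, 0 ≤ g n) (hg : Summable g) (d : ℕ) :
    Summable (fun k : Fin d → ℤ => ∏ i, g (k i)) := by
  induction d with
  | zero => exact Summable.of_finite
  | succ n ih =>
    rw [← (Fin.consEquiv (fun _ : Fin (n + 1) => ℤ)).summable_iff]
    have := hg.mul_of_nonneg ih h0 (fun k => Finset.prod_nonneg fun i _ => h0 _)
    refine this.congr fun p => ?_
    simp [Fin.prod_univ_succ, Fin.consEquiv]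

lemma summable_one_add_abs_inv_sq : Summable (fun n : ℤ => ((1 + |(n : ℝ)|) ^ 2)⁻¹) := by
  refine Summable.of_norm_bounded_eventually (Real.summable_one_div_int_pow.2 one_lt_two) ?_
  rw [Filter.eventually_cofinite]
  refine (Set.finite_singleton (0 : ℤ)).subset fun n hn => ?_
  by_contra h
  refine hn ?_
  have hn0 : (n : ℝ) ≠ 0 := by exact_mod_cast h
  have hpos : 0 < (n : ℝ) ^ 2 := by positivity
  rw [Real.norm_of_nonneg (by positivity), one_div]
  refine inv_anti₀ hpos ?_
  nlinarith [abs_nonneg (n : ℝ), sq_abs (n : ℝ)]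

/-- Each `1 + |k_i|` is at most `wt k`; squaring and multiplying over `d` coordinates accounts for
the exponent `2 * d` and reduces to a product of one-dimensional sums. -/
lemma summable_wt_inv (d : ℕ) : Summable (fun k : Fin d → ℤ => (wt k ^ (2 * d))⁻¹) := by
  refine Summable.of_nonneg_of_le (fun k => by have := wt_pos k; positivity) (fun k => ?_)
    (summable_prod_pi (fun n => by positivity) summable_one_add_abs_inv_sq d)
  rw [Finset.prod_inv_distrib]
  refine inv_anti₀ (Finset.prod_pos fun i _ => by positivity) ?_
  calc ∏ i, (1 + |(k i : ℝ)|) ^ 2 ≤ ∏ _i : Fin d, wt k ^ 2 := by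
        refine Finset.prod_le_prod (fun i _ => by positivity) fun i _ => ?_
        have := norm_le_pi_norm k i
        rw [Int.norm_eq_abs] at this
        gcongr
        simp only [wt]; linarith
    _ = wt k ^ (2 * d) := by simp [pow_mul]

/-- Rapidly decreasing sequences. -/
def RapidDecay (a : (Fin d → ℤ) → ℂ) : Prop := ∀ n : ℕ, Summable (fun k => wt k ^ n * ‖a k‖)

lemma RapidDecay.summable_norm {a : (Fin d → ℤ) → ℂ} (ha : RapidDecay a) :
    Summable (fun k => ‖a k‖) := by simpa using ha 0

lemma RapidDecay.mul {a b : (Fin d → ℤ) → ℂ} (ha : RapidDecay a)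
    {C : ℝ} {m : ℕ} (hb : ∀ k, ‖b k‖ ≤ C * wt k ^ m) : RapidDecay (fun k => b k * a k) := by
  intro n
  refine Summable.of_nonneg_of_le (fun k => by have := wt_pos k; positivity) (fun k => ?_)
    ((ha (n + m)).mul_left C)
  have := wt_pos k
  rw [norm_mul]
  calc wt k ^ n * (‖b k‖ * ‖a k‖) ≤ wt k ^ n * ((C * wt k ^ m) * ‖a k‖) := by gcongr; exact hb k
    _ = _ := by ring

/-- The sum of a Fourier series. -/
def fsum (a : (Fin d → ℤ) → ℂ) (x : Torus d) : ℂ := ∑' k, a k * mFourier k x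

/-- The Fourier coefficients. -/
def fc (f : Torus d → ℂ) (k : Fin d → ℤ) : ℂ := ∫ x, mFourier (-k) x * f x

lemma norm_mFourier_apply (k : Fin d → ℤ) (x : Torus d) : ‖mFourier k x‖ = 1 := by
  simp [mFourier, Circle.norm_coe]

/-- The linear form `y ↦ k · y`. -/
def freq (k : Fin d → ℤ) : (Fin d → ℝ) →L[ℝ] ℝ :=
  ∑ i, (k i : ℝ) • ContinuousLinearMap.proj (R := ℝ) (φ := fun _ : Fin d => ℝ) i

lemma freq_apply (k : Fin d → ℤ) (y : Fin d → ℝ) : freq k y = ∑ i, (k i : ℝ) * y i := by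
  simp [freq]

lemma norm_freq_le (k : Fin d → ℤ) : ‖freq k‖ ≤ d * wt k := by
  refine ContinuousLinearMap.opNorm_le_bound _ (by have := wt_pos k; positivity) fun y => ?_
  rw [freq_apply]
  refine (norm_sum_le _ _).trans ?_
  calc ∑ i, ‖(k i : ℝ) * y i‖ ≤ ∑ _i : Fin d, wt k * ‖y‖ := by
        refine Finset.sum_le_sum fun i _ => ?_
        rw [norm_mul]
        exact mul_le_mul (abs_le_wt k i) (norm_le_pi_norm y i) (norm_nonneg _) (wt_pos k).le
    _ = _ := by simp [mul_assoc]

/-- The character `t ↦ e^{2πit}` of the line. -/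
def expi (t : ℝ) : ℂ := Complex.exp (2 * Real.pi * Complex.I * t)

lemma hasDerivAt_expi (t : ℝ) : HasDerivAt expi (2 * Real.pi * Complex.I * expi t) t := by
  have h1 : HasDerivAt (fun t : ℝ => 2 * Real.pi * Complex.I * (t : ℂ))
      (2 * Real.pi * Complex.I * 1) t :=
    (Complex.ofRealCLM.hasDerivAt (x := t)).const_mul _
  convert! h1.cexp using 1
  simp only [expi]; ring

lemma contDiff_expi : ContDiff ℝ ∞ expi := by
  unfold expi
  exact (contDiff_const.mul Complex.ofRealCLM.contDiff).cexp

lemma iteratedDeriv_expi (n : ℕ) :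
    iteratedDeriv n expi = fun t => (2 * Real.pi * Complex.I) ^ n * expi t := by
  induction n with
  | zero => simp
  | succ n ih =>
    rw [iteratedDeriv_succ, ih]
    funext t
    rw [((hasDerivAt_expi t).const_mul _).deriv]
    ring

lemma norm_expi (t : ℝ) : ‖expi t‖ = 1 := by
  have : expi t = Complex.exp ((2 * Real.pi * t : ℝ) * Complex.I) := by
    unfold expi; push_cast; ring_nf
  rw [this, Complex.norm_exp_ofReal_mul_I]

lemma mFourier_proj (k : Fin d → ℤ) (y : Fin d → ℝ) : mFourier k (proj y) = expi (freq k y) := by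
  simp only [mFourier, ContinuousMap.coe_mk, proj, fourier_coe_apply, expi, freq_apply]
  rw [← Complex.exp_sum]
  push_cast
  rw [Finset.mul_sum]
  congr 1
  exact Finset.sum_congr rfl fun i _ => by ring_nf

/-- Polynomial growth in `k` of the derivatives of the characters, which rapid decay of the
coefficients absorbs in `smooth_fsum`. -/
lemma norm_iteratedFDeriv_mFourier_le (k : Fin d → ℤ) (n : ℕ) (y : Fin d → ℝ) :
    ‖iteratedFDeriv ℝ n (fun y : Fin d → ℝ => mFourier k (proj y)) y‖ ≤
      (2 * Real.pi * d) ^ n * wt k ^ n := by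
  have h1 : (fun y : Fin d → ℝ => mFourier k (proj y)) = expi ∘ freq k :=
    funext fun y => mFourier_proj k y
  rw [h1, ContinuousLinearMap.iteratedFDeriv_comp_right (freq k) contDiff_expi y
    (i := n) (by exact_mod_cast le_top)]
  refine (ContinuousMultilinearMap.norm_compContinuousLinearMap_le _ _).trans ?_
  rw [norm_iteratedFDeriv_eq_norm_iteratedDeriv, iteratedDeriv_expi]
  simp only [norm_mul, norm_pow, norm_expi, Finset.prod_const, Finset.card_univ, Fintype.card_fin,
    mul_one, Complex.norm_I, Complex.norm_real, Complex.norm_ofNat,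
    Real.norm_of_nonneg Real.pi_pos.le]
  rw [← mul_pow, ← mul_pow, mul_assoc (2 * Real.pi)]
  have := Real.pi_pos
  exact pow_le_pow_left₀ (by positivity)
    (mul_le_mul_of_nonneg_left (norm_freq_le k) (by positivity)) n

lemma smooth_mFourier (k : Fin d → ℤ) : Smooth (fun x : Torus d => mFourier k x) := by
  have h1 : (fun y : Fin d → ℝ => mFourier k (proj y)) = expi ∘ freq k :=
    funext fun y => mFourier_proj k y
  unfold Smooth
  rw [h1]
  exact contDiff_expi.comp (freq k).contDiff

lemma smooth_fsum {a : (Fin d → ℤ) → ℂ} (ha : RapidDecay a) : Smooth (fsum a) := by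
  unfold Smooth fsum
  refine contDiff_tsum (N := ⊤) (v := fun n k => (2 * Real.pi * d) ^ n * (wt k ^ n * ‖a k‖))
    (fun k => contDiff_const.mul (smooth_mFourier k))
    (fun n _ => (ha n).mul_left _) fun n k y _ => ?_
  have : (fun y : Fin d → ℝ => a k * mFourier k (proj y)) =
      a k • fun y : Fin d → ℝ => mFourier k (proj y) := rfl
  rw [this, iteratedFDeriv_const_smul_apply (((smooth_mFourier k).of_le
    (by exact_mod_cast le_top)).contDiffAt), norm_smul]
  calc _ ≤ ‖a k‖ * ((2 * Real.pi * d) ^ n * wt k ^ n) := by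
        gcongr; exact norm_iteratedFDeriv_mFourier_le k n y
    _ = _ := by ring

lemma mFourier_line (k : Fin d → ℤ) (i : Fin d) (x : Torus d) (s : ℝ) :
    mFourier k (x + Pi.single i (s : UnitAddCircle)) = mFourier k x * expi (k i * s) := by
  obtain ⟨y, rfl⟩ := surjective_proj x
  rw [← proj_single, ← proj_add, mFourier_proj, mFourier_proj, map_add]
  have : freq k (Pi.single i s) = k i * s := by
    rw [freq_apply, Finset.sum_eq_single i] <;> simp +contextual
  rw [this]
  simp only [expi, ← Complex.exp_add]
  push_cast
  ring_nf

lemma hasDerivAt_mFourier_line (k : Fin d → ℤ) (i : Fin d) (x : Torus d) (s : ℝ) :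
    HasDerivAt (fun s : ℝ => mFourier k (x + Pi.single i (s : UnitAddCircle)))
      (2 * Real.pi * Complex.I * k i * mFourier k (x + Pi.single i (s : UnitAddCircle))) s := by
  simp only [mFourier_line]
  have h2 : HasDerivAt (fun s : ℝ => (k i : ℝ) * s) (k i) s := by
    simpa using (hasDerivAt_id s).const_mul (k i : ℝ)
  have h := ((hasDerivAt_expi _).scomp s h2).const_mul (mFourier k x)
  convert! h using 1
  rw [Complex.real_smul]; push_cast; ring

lemma tderiv_mFourier (k : Fin d → ℤ) (i : Fin d) :
    tderiv i (fun x : Torus d => mFourier k x) =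
      fun x => 2 * Real.pi * Complex.I * k i * mFourier k x := by
  funext x
  refine (hasDerivAt_mFourier_line k i x 0).deriv.trans ?_
  simp

lemma norm_two_pi_I_mul (k : Fin d → ℤ) (i : Fin d) :
    ‖2 * Real.pi * Complex.I * (k i : ℂ)‖ ≤ 2 * Real.pi * wt k ^ 1 := by
  have := abs_le_wt k i
  have := Real.pi_pos
  simp only [norm_mul, Complex.norm_I, Complex.norm_real, Complex.norm_ofNat, mul_one, pow_one,
    Real.norm_of_nonneg Real.pi_pos.le, Complex.norm_intCast]
  gcongr

lemma summable_fsum {a : (Fin d → ℤ) → ℂ} (ha : Summable fun k => ‖a k‖) (x : Torus d) :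
    Summable (fun k => ‖a k * mFourier k x‖) := by
  simpa [norm_mFourier_apply] using ha

lemma tderiv_fsum {a : (Fin d → ℤ) → ℂ} (ha : RapidDecay a) (i : Fin d) :
    tderiv i (fsum a) = fsum (fun k => 2 * Real.pi * Complex.I * k i * a k) := by
  have hb : RapidDecay (fun k => 2 * Real.pi * Complex.I * k i * a k) :=
    ha.mul fun k => norm_two_pi_I_mul k i
  funext x
  have h := hasDerivAt_tsum (𝕜 := ℝ) hb.summable_norm
    (fun k s => (hasDerivAt_mFourier_line k i x s).const_mul (a k))
    (fun k s => by
      rw [norm_mul (a k), norm_mul (2 * Real.pi * Complex.I * (k i : ℂ)), norm_mFourier_apply,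
        norm_mul (2 * Real.pi * Complex.I * (k i : ℂ))]
      exact le_of_eq (by ring)) (y₀ := 0)
    (summable_fsum ha.summable_norm _).of_norm 0
  refine h.deriv.trans (tsum_congr fun k => ?_)
  simp only [QuotientAddGroup.mk_zero, Pi.single_zero, add_zero]
  ring

lemma integral_mFourier (k : Fin d → ℤ) :
    ∫ x : Torus d, mFourier k x = if k = 0 then 1 else 0 := by
  split_ifs with h
  · subst h; simp [mFourier_zero]
  · obtain ⟨i, hi⟩ := Function.ne_iff.1 h
    -- With `k i ≠ 0`, the character is a nonzero multiple of its own derivative, which integrates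
    -- to zero.
    have h0 := integral_tderiv (smooth_mFourier k) i
    rw [tderiv_mFourier, integral_const_mul] at h0
    refine (mul_eq_zero.1 h0).resolve_left ?_
    have : (k i : ℂ) ≠ 0 := by exact_mod_cast hi
    simp [Real.pi_ne_zero, this]

lemma integral_fsum {a : (Fin d → ℤ) → ℂ} (ha : Summable fun k => ‖a k‖) :
    ∫ x, fsum a x = a 0 := by
  unfold fsum
  rw [← integral_tsum_of_summable_integral_norm (F := fun k x => a k * mFourier k x)
    (fun k => ((smooth_mFourier k).integrable).const_mul _)
    (by simpa [norm_mFourier_apply] using ha)]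
  simp only [integral_const_mul, integral_mFourier]
  rw [tsum_eq_single 0 (by simp +contextual)]
  simp

/-- Multiplying by the character of frequency `-k` shifts the coefficients by `k`, so only the
zeroth coefficient has to be integrated. -/
lemma fc_fsum {a : (Fin d → ℤ) → ℂ} (ha : Summable fun k => ‖a k‖) : fc (fsum a) = a := by
  funext k
  have h1 : ∀ x, mFourier (-k) x * fsum a x = fsum (fun l => a (l + k)) x := by
    intro x
    unfold fsum
    rw [← tsum_mul_left, ← (Equiv.addRight k).tsum_eq]
    refine tsum_congr fun l => ?_
    have h2 : mFourier l x = mFourier (-k) x * mFourier (l + k) x := by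
      rw [← mFourier_add, neg_add_eq_sub, add_sub_cancel_right]
    rw [Equiv.coe_addRight, h2, mul_left_comm]
  have h3 : Summable (fun l => ‖a (l + k)‖) :=
    (Equiv.addRight k).summable_iff (f := fun l => ‖a l‖) |>.2 ha
  have h4 : fc (fsum a) k = ∫ x, fsum (fun l => a (l + k)) x := by
    unfold fc
    simp only [h1]
  rw [h4, integral_fsum h3, zero_add]

lemma fc_tderiv {f : Torus d → ℂ} (hf : Smooth f) (i : Fin d) (k : Fin d → ℤ) :
    fc (tderiv i f) k = 2 * Real.pi * Complex.I * k i * fc f k := by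
  have hs := smooth_mFourier (d := d) (-k)
  have h0 := integral_tderiv (hs.mul hf) i
  rw [tderiv_mul hs hf, integral_add' ((hs.tderiv i).mul hf).integrable
    (hs.mul (hf.tderiv i)).integrable, tderiv_mFourier] at h0
  simp only [Pi.mul_apply, mul_assoc] at h0
  simp only [Pi.neg_apply, Int.cast_neg, neg_mul, mul_neg, integral_neg] at h0
  simp only [fc, mul_assoc]
  simp only [integral_const_mul] at h0 ⊢
  linear_combination h0

/-- An additional factor `wt k` is at most `1 + ∑ |k_i|`, and each `|k_i|` is paid for by one
derivative of `f`. -/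
lemma exists_norm_fc_le (n : ℕ) {f : Torus d → ℂ} (hf : Smooth f) :
    ∃ C, ∀ k, wt k ^ n * ‖fc f k‖ ≤ C := by
  induction n generalizing f with
  | zero =>
    refine ⟨∫ x, ‖f x‖, fun k => ?_⟩
    rw [pow_zero, one_mul]
    refine (norm_integral_le_integral_norm _).trans (le_of_eq ?_)
    simp [norm_mFourier_apply]
  | succ n ih =>
    obtain ⟨C, hC⟩ := ih hf
    choose D hD using fun i => ih (hf.tderiv i)
    refine ⟨C + ∑ i, D i, fun k => ?_⟩
    have h1 : ‖k‖ ≤ ∑ i, |(k i : ℝ)| :=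
      (pi_norm_le_iff_of_nonneg (Finset.sum_nonneg fun i _ => abs_nonneg _)).2 fun i => by
        rw [Int.norm_eq_abs]
        exact Finset.single_le_sum (f := fun i => |(k i : ℝ)|) (fun i _ => abs_nonneg _)
          (Finset.mem_univ i)
    have hw := wt_pos k
    have h2 : ∀ i, wt k ^ n * ‖fc f k‖ * |(k i : ℝ)| ≤ D i := by
      intro i
      refine le_trans ?_ (hD i k)
      rw [fc_tderiv hf, mul_assoc, norm_mul]
      have : |(k i : ℝ)| ≤ ‖2 * Real.pi * Complex.I * (k i : ℂ)‖ := by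
        simp only [norm_mul, Complex.norm_I, Complex.norm_real, Complex.norm_ofNat, mul_one,
          Real.norm_of_nonneg Real.pi_pos.le, Complex.norm_intCast]
        nlinarith [Real.pi_gt_three, abs_nonneg (k i : ℝ)]
      rw [mul_comm ‖fc f k‖]
      gcongr
    calc wt k ^ (n + 1) * ‖fc f k‖ = wt k ^ n * ‖fc f k‖ + wt k ^ n * ‖fc f k‖ * ‖k‖ := by
          rw [pow_succ]; nth_rewrite 2 [wt]; ring
      _ ≤ wt k ^ n * ‖fc f k‖ + wt k ^ n * ‖fc f k‖ * ∑ i, |(k i : ℝ)| := by gcongr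
      _ ≤ C + ∑ i, D i := by
          rw [Finset.mul_sum]
          exact add_le_add (hC k) (Finset.sum_le_sum fun i _ => h2 i)

lemma rapidDecay_fc {f : Torus d → ℂ} (hf : Smooth f) : RapidDecay (fc f) := by
  intro n
  -- The `2 * d` spare powers upgrade boundedness to summability.
  obtain ⟨C, hC⟩ := exists_norm_fc_le (n + 2 * d) hf
  refine Summable.of_nonneg_of_le (fun k => by have := wt_pos k; positivity) (fun k => ?_)
    ((summable_wt_inv d).mul_left C)
  have hw := wt_pos k
  rw [← div_eq_mul_inv, le_div_iff₀ (by positivity)]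
  calc _ = wt k ^ (n + 2 * d) * ‖fc f k‖ := by ring
    _ ≤ C := hC k

/-- `fc` integrates against `volume`, `mFourierCoeff` against the product of `haarAddCircle`. -/
lemma volume_torus_eq (d : ℕ) :
    (volume : Measure (Torus d)) = Measure.pi fun _ => AddCircle.haarAddCircle := by
  have : (volume : Measure UnitAddCircle) = AddCircle.haarAddCircle := by
    rw [AddCircle.volume_eq_smul_haarAddCircle]; simp
  rw [← this]; rfl

lemma mFourierCoeff_eq_fc (f : Torus d → ℂ) : mFourierCoeff f = fc f := by
  unfold fc
  rw [volume_torus_eq]; rfl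

lemma fsum_fc {f : Torus d → ℂ} (hf : Smooth f) : fsum (fc f) = f := by
  funext x
  have h : Summable (mFourierCoeff (⟨f, hf.continuous⟩ : C(UnitAddTorus (Fin d), ℂ))) := by
    rw [ContinuousMap.coe_mk, mFourierCoeff_eq_fc]
    exact (rapidDecay_fc hf).summable_norm.of_norm
  have h2 := hasSum_mFourier_series_apply_of_summable h x
  simp only [ContinuousMap.coe_mk, mFourierCoeff_eq_fc] at h2
  exact h2.tsum_eq

/-- The convolution of two sequences. -/
def conv (a b : (Fin d → ℤ) → ℂ) (k : Fin d → ℤ) : ℂ := ∑' l, a (k - l) * b l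

/-- The shear `(k, l) ↦ (k - l, l)`. -/
def shear (d : ℕ) : (Fin d → ℤ) × (Fin d → ℤ) ≃ (Fin d → ℤ) × (Fin d → ℤ) where
  toFun p := (p.1 - p.2, p.2)
  invFun p := (p.1 + p.2, p.2)
  left_inv p := by simp
  right_inv p := by simp

lemma summable_conv_pair {a b : (Fin d → ℤ) → ℂ} (ha : Summable fun k => ‖a k‖)
    (hb : Summable fun k => ‖b k‖) :
    Summable (fun p : (Fin d → ℤ) × (Fin d → ℤ) => ‖a (p.1 - p.2) * b p.2‖) := by
  have := (shear d).summable_iff.2 (ha.mul_of_nonneg hb (fun _ => norm_nonneg _)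
    (fun _ => norm_nonneg _))
  simpa [Function.comp_def, shear] using this

/-- Absolute convergence of the double series allows summing along the shear, that is, by total
frequency. -/
lemma fsum_conv {a b : (Fin d → ℤ) → ℂ} (ha : Summable fun k => ‖a k‖)
    (hb : Summable fun k => ‖b k‖) : fsum (conv a b) = fsum a * fsum b := by
  funext x
  simp only [Pi.mul_apply, fsum]
  rw [tsum_mul_tsum_of_summable_norm (summable_fsum ha x) (summable_fsum hb x),
    ← (shear d).tsum_eq]
  have hs : Summable (fun p : (Fin d → ℤ) × (Fin d → ℤ) =>
      a (p.1 - p.2) * b p.2 * mFourier p.1 x) := by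
    refine Summable.of_norm ?_
    simpa [norm_mFourier_apply] using summable_conv_pair ha hb
  have hs' : ∀ p : (Fin d → ℤ) × (Fin d → ℤ), a ((shear d) p).1 * mFourier ((shear d) p).1 x *
      (b ((shear d) p).2 * mFourier ((shear d) p).2 x) =
      a (p.1 - p.2) * b p.2 * mFourier p.1 x := by
    intro p
    have : mFourier p.1 x = mFourier (p.1 - p.2) x * mFourier p.2 x := by
      rw [← mFourier_add]; simp
    simp only [shear, Equiv.coe_fn_mk]
    rw [this]; ring
  simp only [hs']
  rw [hs.tsum_prod]
  refine tsum_congr fun k => ?_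
  rw [conv]
  exact tsum_mul_right.symm

/-- Young's inequality in weighted `ℓ¹`, via `wt k ≤ wt (k - l) * wt l`. The case `n = 0` bounds the
convolution operator, the general case drives the bootstrap. -/
lemma summable_wt_conv (n : ℕ) {a b : (Fin d → ℤ) → ℂ}
    (ha : Summable fun k => wt k ^ n * ‖a k‖) (hb : Summable fun k => wt k ^ n * ‖b k‖) :
    Summable (fun k => wt k ^ n * ‖conv a b k‖) ∧
      ∑' k, wt k ^ n * ‖conv a b k‖ ≤ (∑' k, wt k ^ n * ‖a k‖) * ∑' k, wt k ^ n * ‖b k‖ := by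
  have hw := fun k : Fin d → ℤ => wt_pos k
  have ha0 : ∀ k, 0 ≤ wt k ^ n * ‖a k‖ := fun k => by have := hw k; positivity
  have hb0 : ∀ k, 0 ≤ wt k ^ n * ‖b k‖ := fun k => by have := hw k; positivity
  have hp : Summable (fun p : (Fin d → ℤ) × (Fin d → ℤ) =>
      wt (p.1 - p.2) ^ n * ‖a (p.1 - p.2)‖ * (wt p.2 ^ n * ‖b p.2‖)) := by
    have := (shear d).summable_iff.2 (ha.mul_of_nonneg hb ha0 hb0)
    simpa [Function.comp_def, shear] using this
  have hle : ∀ k, wt k ^ n * ‖conv a b k‖ ≤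
      ∑' l, wt (k - l) ^ n * ‖a (k - l)‖ * (wt l ^ n * ‖b l‖) := by
    intro k
    have h1 : ∀ l, wt k ^ n * ‖a (k - l) * b l‖ ≤
        wt (k - l) ^ n * ‖a (k - l)‖ * (wt l ^ n * ‖b l‖) := by
      intro l
      have h2 : wt k ^ n ≤ wt (k - l) ^ n * wt l ^ n := by
        rw [← mul_pow]
        have := wt_add_le (k - l) l
        rw [sub_add_cancel] at this
        have := hw k
        gcongr
      rw [norm_mul]
      calc _ ≤ wt (k - l) ^ n * wt l ^ n * (‖a (k - l)‖ * ‖b l‖) := by gcongr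
        _ = _ := by ring
    have h3 := hp.prod_factor k
    have h5 : Summable (fun l => wt k ^ n * ‖a (k - l) * b l‖) :=
      Summable.of_nonneg_of_le (fun l => by have := hw k; positivity) h1 h3
    have h4 : Summable (fun l => ‖a (k - l) * b l‖) := by
      rwa [summable_mul_left_iff (pow_ne_zero _ (hw k).ne')] at h5
    calc _ ≤ wt k ^ n * ∑' l, ‖a (k - l) * b l‖ := by
          have := hw k
          gcongr
          exact norm_tsum_le_tsum_norm h4
      _ = ∑' l, wt k ^ n * ‖a (k - l) * b l‖ := tsum_mul_left.symm
      _ ≤ _ := h5.tsum_le_tsum h1 h3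
  have hs : Summable (fun k => wt k ^ n * ‖conv a b k‖) :=
    Summable.of_nonneg_of_le (fun k => by have := hw k; positivity) hle hp.prod
  refine ⟨hs, (hs.tsum_le_tsum hle hp.prod).trans (le_of_eq ?_)⟩
  rw [ha.tsum_mul_tsum hb (ha.mul_of_nonneg hb ha0 hb0), ← hp.tsum_prod,
    ← (shear d).tsum_eq (fun z => wt z.1 ^ n * ‖a z.1‖ * (wt z.2 ^ n * ‖b z.2‖))]
  rfl

lemma laplacian_fsum {a : (Fin d → ℤ) → ℂ} (ha : RapidDecay a) :
    laplacian (fsum a) =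
      fsum (fun k => ((-(4 * Real.pi ^ 2 * ∑ i, (k i : ℝ) ^ 2) : ℝ) : ℂ) * a k) := by
  have hb : ∀ i, RapidDecay (fun k => 2 * Real.pi * Complex.I * k i * a k) :=
    fun i => ha.mul fun k => norm_two_pi_I_mul k i
  have hc : ∀ i, RapidDecay
      (fun k => 2 * Real.pi * Complex.I * k i * (2 * Real.pi * Complex.I * k i * a k)) :=
    fun i => (hb i).mul fun k => norm_two_pi_I_mul k i
  funext x
  simp only [laplacian, tderiv_fsum ha, tderiv_fsum (hb _)]
  simp only [fsum]
  rw [← Summable.tsum_finsetSum fun i _ => (summable_fsum (hc i).summable_norm x).of_norm]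
  refine tsum_congr fun k => ?_
  rw [← Finset.sum_mul]
  congr 1
  push_cast
  rw [Finset.mul_sum, ← Finset.sum_neg_distrib, Finset.sum_mul]
  refine Finset.sum_congr rfl fun i _ => ?_
  linear_combination (4 * Real.pi ^ 2 * (k i : ℂ) ^ 2 * a k) * Complex.I_sq

end Fourier

/-! ### Diagonal operators on `ℓ¹` and their compactness. -/

section SequenceSpace

variable {α : Type*}

/-- Absolutely summable complex families. -/
abbrev L1 (α : Type*) : Type _ := lp (fun _ : α => ℂ) 1

lemma memℓp_one_iff {a : α → ℂ} : Memℓp a 1 ↔ Summable fun k => ‖a k‖ := by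
  simpa using memℓp_gen_iff (p := 1) (f := a) (by simp)

lemma L1.norm_eq (a : L1 α) : ‖a‖ = ∑' k, ‖a k‖ := by
  simpa using lp.norm_eq_tsum_rpow (p := 1) (by simp) a

lemma L1.summable (a : L1 α) : Summable fun k => ‖a k‖ := memℓp_one_iff.1 (lp.memℓp a)

/-- A linear map of sequences, bounded in `ℓ¹`. -/
def L1.mkCLM (T : (α → ℂ) → α → ℂ) (C : ℝ)
    (hadd : ∀ a b : L1 α, T (⇑a + ⇑b) = T a + T b)
    (hsmul : ∀ (c : ℂ) (a : L1 α), T (c • ⇑a) = c • T a)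
    (h : ∀ a : L1 α, Summable (fun k => ‖T a k‖) ∧ ∑' k, ‖T a k‖ ≤ C * ∑' k, ‖a k‖) :
    L1 α →L[ℂ] L1 α :=
  LinearMap.mkContinuous
    { toFun := fun a => ⟨T a, memℓp_one_iff.2 (h a).1⟩
      map_add' := fun a b => lp.ext (by
        change T ⇑(a + b) = T a + T b
        rw [lp.coeFn_add, hadd])
      map_smul' := fun c a => lp.ext (by
        change T ⇑(c • a) = c • T a
        rw [lp.coeFn_smul, hsmul]) } C
    fun a => by
      rw [L1.norm_eq, L1.norm_eq]
      exact (h a).2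

/-- The diagonal operator with bounded entries. -/
def L1.diag (m : α → ℂ) (C : ℝ) (hm : ∀ k, ‖m k‖ ≤ C) : L1 α →L[ℂ] L1 α :=
  L1.mkCLM (fun a k => m k * a k) C
    (fun a b => by funext k; simp [mul_add])
    (fun c a => by funext k; simp [mul_left_comm])
    (fun a => by
      have hle : ∀ k, ‖m k * a k‖ ≤ C * ‖a k‖ := fun k => by
        rw [norm_mul]; exact mul_le_mul_of_nonneg_right (hm k) (norm_nonneg _)
      have hs := Summable.of_nonneg_of_le (fun k => norm_nonneg _) hle (a.summable.mul_left C)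
      exact ⟨hs, (hs.tsum_le_tsum hle (a.summable.mul_left C)).trans_eq tsum_mul_left⟩)

lemma L1.diag_apply (m : α → ℂ) (C : ℝ) (hm : ∀ k, ‖m k‖ ≤ C) (a : L1 α) (k : α) :
    L1.diag m C hm a k = m k * a k := rfl

/-- Entries tending to zero make the operator a norm limit of its finite truncations, which have
finite rank. -/
lemma L1.isCompactOperator_diag (m : α → ℂ) (C : ℝ) (hm : ∀ k, ‖m k‖ ≤ C)
    (h0 : ∀ ε > 0, {k | ε ≤ ‖m k‖}.Finite) : IsCompactOperator (L1.diag m C hm) := by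
  classical
  let P : α → L1 α →L[ℂ] L1 α := fun k =>
    m k • (lp.singleContinuousLinearMap ℂ (fun _ : α => ℂ) 1 k ∘L
      lp.evalCLM ℂ (fun _ : α => ℂ) 1 k)
  have hP : ∀ k a j, P k a j = if j = k then m k * a k else 0 := by
    intro k a j
    by_cases h : j = k
    · subst h
      simp only [P, if_true]
      change m j • (lp.single (E := fun _ : α => ℂ) 1 j (a j)) j = _
      simp
    · simp [P, h]
  have hcomp : ∀ S : Finset α, IsCompactOperator (∑ k ∈ S, P k : L1 α →L[ℂ] L1 α) := by
    intro S
    have hk : ∀ k, P k ∈ compactOperator (RingHom.id ℂ) (L1 α) (L1 α) := fun k => by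
      refine IsCompactOperator.smul ?_ (m k)
      exact (isCompactOperator_of_locallyCompactSpace_rng
        (lp.singleContinuousLinearMap ℂ (fun _ : α => ℂ) 1 k)).comp_clm (lp.evalCLM ℂ (fun _ : α => ℂ) 1 k)
    exact (compactOperator (RingHom.id ℂ) (L1 α) (L1 α)).sum_mem fun k _ => hk k
  refine isCompactOperator_of_tendsto (l := atTop) (F := fun S : Finset α => ∑ k ∈ S, P k) ?_
    (Eventually.of_forall hcomp)
  rw [Metric.tendsto_atTop]
  intro ε hε
  -- Outside this finite set all entries are below `ε / 2`, which bounds the norm of the remainder.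
  refine ⟨(h0 (ε / 2) (half_pos hε)).toFinset, fun S hS => ?_⟩
  rw [dist_eq_norm]
  refine lt_of_le_of_lt (ContinuousLinearMap.opNorm_le_bound _ (half_pos hε).le fun a => ?_)
    (half_lt_self hε)
  rw [L1.norm_eq, L1.norm_eq, ← tsum_mul_left]
  refine (L1.summable _).tsum_le_tsum (fun j => ?_) (a.summable.mul_left _)
  have : ((∑ k ∈ S, P k - L1.diag m C hm) a) j =
      (if j ∈ S then m j * a j else 0) - m j * a j := by
    rw [sub_apply, sum_apply, lp.coeFn_sub, Pi.sub_apply,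
      lp.coeFn_sum, Finset.sum_apply, L1.diag_apply]
    simp [hP]
  rw [this]
  by_cases hj : j ∈ S
  · simp only [hj, if_true, sub_self, norm_zero]; positivity
  · have hlt : ‖m j‖ < ε / 2 := by
      by_contra hcon
      exact hj (hS (by simpa using hcon))
    simp only [hj, if_false, zero_sub, norm_neg, norm_mul]
    gcongr

end SequenceSpace

/-! ### Schrödinger equations on the torus and solvability of `Δ_ρ Φ = σ`. -/

section Schrodinger

variable {d : ℕ}

/-- Convolution by a summable sequence. -/
def convCLM (q : (Fin d → ℤ) → ℂ) (hq : Summable fun k => ‖q k‖) :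
    L1 (Fin d → ℤ) →L[ℂ] L1 (Fin d → ℤ) :=
  have hsum : ∀ (a : L1 (Fin d → ℤ)) k, Summable fun l => q (k - l) * a l := fun a k =>
    ((summable_conv_pair hq a.summable).prod_factor k).of_norm
  L1.mkCLM (conv q) (∑' k, ‖q k‖)
    (fun a b => by
      funext k
      simp only [conv, Pi.add_apply, mul_add]
      exact (hsum a k).tsum_add (hsum b k))
    (fun c a => by
      funext k
      simp only [conv, Pi.smul_apply, smul_eq_mul, mul_left_comm _ c]
      exact tsum_mul_left)
    (fun a => by simpa using summable_wt_conv 0 (by simpa using hq) (by simpa using a.summable))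

/-- The symbol of `(Δ - 1)⁻¹`. -/
def resolventSymbol (k : Fin d → ℤ) : ℂ :=
  ((-(1 + 4 * Real.pi ^ 2 * ∑ i, (k i : ℝ) ^ 2)⁻¹ : ℝ) : ℂ)

/-- The symbol decays quadratically; one power of `wt` is enough both for compactness and for the
bootstrap. -/
lemma norm_resolventSymbol_le (k : Fin d → ℤ) : ‖resolventSymbol k‖ ≤ 2 * (wt k)⁻¹ := by
  have hS : 0 ≤ ∑ i, (k i : ℝ) ^ 2 := Finset.sum_nonneg fun i _ => sq_nonneg _
  have h1 : ‖k‖ ≤ Real.sqrt (∑ i, (k i : ℝ) ^ 2) :=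
    (pi_norm_le_iff_of_nonneg (Real.sqrt_nonneg _)).2 fun i => by
      rw [Int.norm_eq_abs]
      refine Real.abs_le_sqrt ?_
      exact Finset.single_le_sum (f := fun i => (k i : ℝ) ^ 2) (fun i _ => sq_nonneg _)
        (Finset.mem_univ i)
  have h2 : ‖k‖ ^ 2 ≤ ∑ i, (k i : ℝ) ^ 2 := by
    rw [← Real.sq_sqrt hS]; gcongr
  have hw := wt_pos k
  have hpi := Real.pi_gt_three
  rw [resolventSymbol, Complex.norm_real, norm_neg, norm_inv, Real.norm_of_nonneg (by positivity),
    ← div_eq_mul_inv, inv_eq_one_div, div_le_div_iff₀ (by positivity) hw, one_mul]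
  have h3 : ∑ i, (k i : ℝ) ^ 2 ≤ 4 * Real.pi ^ 2 * ∑ i, (k i : ℝ) ^ 2 :=
    le_mul_of_one_le_left hS (by nlinarith)
  simp only [wt]
  nlinarith [sq_nonneg (‖k‖ - 1)]

lemma finite_le_norm_resolventSymbol (ε : ℝ) (hε : 0 < ε) :
    {k : Fin d → ℤ | ε ≤ ‖resolventSymbol k‖}.Finite := by
  refine (isCompact_closedBall (0 : Fin d → ℤ) (2 / ε)).finite_of_discrete.subset
    fun k hk => ?_
  have h1 : ε ≤ 2 * (wt k)⁻¹ := le_trans hk (norm_resolventSymbol_le k)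
  have hw := wt_pos k
  rw [← div_eq_mul_inv, le_div_iff₀ hw] at h1
  rw [mem_closedBall_zero_iff, le_div_iff₀ hε]
  simp only [wt] at h1
  nlinarith

/-- Elliptic bootstrap: convolution with `q` preserves the weighted `ℓ¹` spaces and the resolvent
gains one power of the weight, so the equation improves its own solution indefinitely. -/
lemma rapidDecay_of_fixed_point {a q g : (Fin d → ℤ) → ℂ} (hq : RapidDecay q)
    (hg : RapidDecay g) (ha : Summable fun k => ‖a k‖)
    (h : ∀ k, a k = resolventSymbol k * (conv q a k + g k)) : RapidDecay a := by
  intro n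
  induction n with
  | zero => simpa using ha
  | succ n ih =>
    refine Summable.of_nonneg_of_le (fun k => by have := wt_pos k; positivity) (fun k => ?_)
      (((summable_wt_conv n (hq n) ih).1.add (hg n)).mul_left 2)
    have hw := wt_pos k
    rw [h k]
    rw [norm_mul]
    calc wt k ^ (n + 1) * (‖resolventSymbol k‖ * ‖conv q a k + g k‖)
        ≤ wt k ^ (n + 1) * ((2 * (wt k)⁻¹) * (‖conv q a k‖ + ‖g k‖)) := by
          gcongr
          · exact norm_resolventSymbol_le k
          · exact norm_add_le _ _
      _ = _ := by field_simp; ring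

lemma fsum_add {a b : (Fin d → ℤ) → ℂ} (ha : Summable fun k => ‖a k‖)
    (hb : Summable fun k => ‖b k‖) : fsum (a + b) = fsum a + fsum b := by
  funext x
  simp only [fsum, Pi.add_apply, add_mul]
  exact (summable_fsum ha x).of_norm.tsum_add (summable_fsum hb x).of_norm

/-- Dividing by the resolvent symbol turns the fixed point equation into `(Δ - 1) u = q u + g` on
the Fourier side. -/
lemma laplacian_fsum_of_fixed_point {a q g : (Fin d → ℤ) → ℂ} (hq : RapidDecay q)
    (hg : RapidDecay g) (ha : RapidDecay a)
    (h : ∀ k, a k = resolventSymbol k * (conv q a k + g k)) :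
    laplacian (fsum a) = fsum q * fsum a + fsum a + fsum g := by
  have hc : Summable fun k => ‖conv q a k‖ := by
    simpa using (summable_wt_conv 0 (hq 0) (ha 0)).1
  have hca : Summable fun k => ‖(conv q a + a) k‖ :=
    Summable.of_nonneg_of_le (fun _ => norm_nonneg _) (fun k => norm_add_le _ _)
      (hc.add ha.summable_norm)
  rw [laplacian_fsum ha, ← fsum_conv hq.summable_norm ha.summable_norm,
    ← fsum_add hc ha.summable_norm, ← fsum_add hca hg.summable_norm]
  congr 1
  funext k
  have hS : 0 ≤ ∑ i, (k i : ℝ) ^ 2 := Finset.sum_nonneg fun i _ => sq_nonneg _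
  have hne : (1 + 4 * Real.pi ^ 2 * ∑ i, (k i : ℝ) ^ 2) ≠ 0 := by positivity
  have hne' : ((1 + 4 * Real.pi ^ 2 * ∑ i, (k i : ℝ) ^ 2 : ℝ) : ℂ) ≠ 0 := by exact_mod_cast hne
  have h1 : ((1 + 4 * Real.pi ^ 2 * ∑ i, (k i : ℝ) ^ 2 : ℝ) : ℂ) * a k =
      -(conv q a k + g k) := by
    rw [h k, resolventSymbol, Complex.ofReal_neg, Complex.ofReal_inv]
    field_simp
  simp only [Pi.add_apply]
  push_cast at h1 ⊢
  linear_combination -h1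

/-- Fredholm alternative for a rank one perturbation of the Schrödinger operator `Δ - q`. -/
lemma exists_schrodinger_complex {q s f : Torus d → ℂ} (hq : Smooth q) (hs : Smooth s)
    (hf : Smooth f)
    (hinj : ∀ u : Torus d → ℂ, Smooth u →
      laplacian u = q * u + (fun x => (∫ y, u y) * s x) → u = 0) :
    ∃ u : Torus d → ℂ, Smooth u ∧
      laplacian u = q * u + (fun x => (∫ y, u y) * s x) + f := by
  -- `Δ - 1` is invertible where `Δ` is not; the shift is compensated in the potential.
  have hq1 : Smooth (q - fun _ => 1) := hq.sub (Smooth.const 1)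
  set Q := fc (q - fun _ => 1) with hQ
  have hQr : RapidDecay Q := rapidDecay_fc hq1
  have hsr : RapidDecay (fc s) := rapidDecay_fc hs
  have hfr : RapidDecay (fc f) := rapidDecay_fc hf
  let σ : L1 (Fin d → ℤ) := ⟨fc s, memℓp_one_iff.2 hsr.summable_norm⟩
  let φ : L1 (Fin d → ℤ) := ⟨fc f, memℓp_one_iff.2 hfr.summable_norm⟩
  have hm : ∀ k : Fin d → ℤ, ‖resolventSymbol k‖ ≤ 2 := fun k =>
    (norm_resolventSymbol_le k).trans
      (mul_le_of_le_one_right zero_le_two (inv_le_one_of_one_le₀ (one_le_wt k)))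
  let D := L1.diag (α := Fin d → ℤ) resolventSymbol 2 hm
  -- The coefficient at frequency `0` is the mean, so the second summand encodes `(∫ u) s`.
  let B := convCLM Q hQr.summable_norm +
    (lp.evalCLM ℂ (fun _ : Fin d → ℤ => ℂ) 1 0).smulRight σ
  have hD : IsCompactOperator D :=
    L1.isCompactOperator_diag _ _ hm finite_le_norm_resolventSymbol
  have hT : IsCompactOperator (D ∘L B) := hD.comp_clm B
  have hTa : ∀ a k, (D ∘L B) a k = resolventSymbol k * (conv Q a k + a 0 * fc s k) :=
    fun a k => rfl
  -- `t = 0` is the homogeneous equation, used for injectivity; `t = 1` is the equation to be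
  -- solved.
  have key : ∀ (a : L1 (Fin d → ℤ)) (t : ℂ),
      (∀ k, a k = resolventSymbol k * (conv Q a k + (a 0 * fc s k + t * fc f k))) →
      Smooth (fsum a) ∧ laplacian (fsum a) =
        q * fsum a + (fun x => (∫ y, fsum a y) * s x) + (fun x => t * f x) := by
    intro a t h
    have hg1 : RapidDecay (fun k => a 0 * fc s k) :=
      hsr.mul (m := 0) (C := ‖a 0‖) fun k => by simp
    have hg2 : RapidDecay (fun k => t * fc f k) := hfr.mul (m := 0) (C := ‖t‖) fun k => by simp
    have hg : RapidDecay (fun k => a 0 * fc s k + t * fc f k) := fun n =>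
      Summable.of_nonneg_of_le (fun k => by have := wt_pos k; positivity)
        (fun k => by
          have := wt_pos k
          calc _ ≤ wt k ^ n * (‖a 0 * fc s k‖ + ‖t * fc f k‖) := by
                gcongr; exact norm_add_le _ _
            _ = _ := mul_add _ _ _) ((hg1 n).add (hg2 n))
    have ha := rapidDecay_of_fixed_point hQr hg a.summable h
    refine ⟨smooth_fsum ha, ?_⟩
    have hsc : ∀ (c : ℂ) (r : Torus d → ℂ), Smooth r →
        fsum (fun k => c * fc r k) = fun x => c * r x := by
      intro c r hr
      funext x
      conv_rhs => rw [← fsum_fc hr]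
      simp only [fsum, mul_assoc]
      exact tsum_mul_left
    have hga : fsum (fun k => a 0 * fc s k + t * fc f k) =
        (fun x => a 0 * s x) + fun x => t * f x := by
      rw [← hsc _ s hs, ← hsc _ f hf]
      exact fsum_add hg1.summable_norm hg2.summable_norm
    rw [laplacian_fsum_of_fixed_point hQr hg ha h, hQ, fsum_fc hq1, hga,
      integral_fsum ha.summable_norm]
    funext x
    simp only [Pi.add_apply, Pi.mul_apply, Pi.sub_apply]
    ring
  -- Fredholm alternative at `1`: an eigenvector would be a nonzero smooth homogeneous solution,
  -- against `hinj`; otherwise `1 - D B` is inverted on `D φ`.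
  rcases hT.hasEigenvalue_or_mem_resolventSet one_ne_zero with he | hr
  · exfalso
    obtain ⟨a, ha⟩ := he.exists_hasEigenvector
    have hfix : (D ∘L B) a = a := by simpa using ha.apply_eq_smul
    have hk := key a 0 fun k => by
      conv_lhs => rw [← hfix, hTa]
      ring
    have hu := hinj _ hk.1 (by rw [hk.2]; funext x; simp)
    have h0 : (⇑a : (Fin d → ℤ) → ℂ) = 0 := by
      rw [← fc_fsum a.summable, hu]
      funext k; simp [fc]
    exact ha.2 (lp.ext h0)
  · rw [spectrum.mem_resolventSet_iff] at hr
    obtain ⟨R, hR⟩ := hr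
    have hinv : (algebraMap ℂ (L1 (Fin d → ℤ) →L[ℂ] L1 (Fin d → ℤ)) 1 - D ∘L B) *
        (↑R⁻¹ : L1 (Fin d → ℤ) →L[ℂ] L1 (Fin d → ℤ)) = 1 := by rw [← hR]; exact R.mul_inv
    set a := (↑R⁻¹ : L1 (Fin d → ℤ) →L[ℂ] L1 (Fin d → ℤ)) (D φ) with ha
    have h1 : a - (D ∘L B) a = D φ := by
      have := congrArg (fun L => L (D φ)) hinv
      simpa using this
    have hk := key a 1 fun k => by
      have h2 := congrArg (fun b : L1 (Fin d → ℤ) => b k) h1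
      simp only [lp.coeFn_sub, Pi.sub_apply, hTa] at h2
      have h3 : D φ k = resolventSymbol k * fc f k := rfl
      rw [h3] at h2
      linear_combination h2
    exact ⟨fsum a, hk.1, by rw [hk.2]; simp⟩

/-- The coefficients are real, so real and imaginary parts separate: they carry injectivity over to
`ℂ`, and the real part of a complex solution is a solution. -/
lemma exists_schrodinger {q s f : Torus d → ℝ} (hq : Smooth q) (hs : Smooth s) (hf : Smooth f)
    (hinj : ∀ u : Torus d → ℝ, Smooth u →
      laplacian u = q * u + (fun x => (∫ y, u y) * s x) → u = 0) :
    ∃ u : Torus d → ℝ, Smooth u ∧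
      laplacian u = q * u + (fun x => (∫ y, u y) * s x) + f := by
  have hre : ∀ u : Torus d → ℂ, Smooth u → ∀ g : Torus d → ℝ,
      laplacian u = (fun x => (q x : ℂ)) * u + (fun x => (∫ y, u y) * (s x : ℂ)) +
        (fun x => (g x : ℂ)) →
      laplacian (fun x => (u x).re) =
        q * (fun x => (u x).re) + (fun x => (∫ y, (u y).re) * s x) + g := by
    intro u hu g h
    have h1 := laplacian_clm hu Complex.reCLM
    simp only [Complex.reCLM_apply] at h1
    rw [h1, h]
    have h2 : (∫ y, (u y).re) = (∫ y, u y).re := integral_re hu.integrable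
    funext x
    simp [h2]
  have him : ∀ u : Torus d → ℂ, Smooth u →
      laplacian u = (fun x => (q x : ℂ)) * u + (fun x => (∫ y, u y) * (s x : ℂ)) →
      laplacian (fun x => (u x).im) =
        q * (fun x => (u x).im) + (fun x => (∫ y, (u y).im) * s x) := by
    intro u hu h
    have h1 := laplacian_clm hu Complex.imCLM
    simp only [Complex.imCLM_apply] at h1
    rw [h1, h]
    have h2 : (∫ y, (u y).im) = (∫ y, u y).im := integral_im hu.integrable
    funext x
    simp [h2]
  obtain ⟨u, hu, h⟩ := exists_schrodinger_complex (hq.clm Complex.ofRealCLM)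
    (hs.clm Complex.ofRealCLM) (hf.clm Complex.ofRealCLM) (fun u hu h => by
      have e1 := hinj _ (hu.clm Complex.reCLM) (by
        have := hre u hu 0 (by rw [h]; funext x; simp)
        simpa using this)
      have e2 := hinj _ (hu.clm Complex.imCLM) (him u hu h)
      funext x
      exact Complex.ext (congrFun e1 x) (congrFun e2 x))
  exact ⟨_, hu.clm Complex.reCLM, hre u hu f h⟩

/-- Solvability of `∇·(ρ∇Φ) = σ` in smooth functions on the torus. -/
theorem exists_weightedLaplacian_eq {ρ σ : Torus d → ℝ} (hρ : Smooth ρ) (hpos : ∀ x, 0 < ρ x)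
    (hσ : Smooth σ) (hσ0 : ∫ x, σ x = 0) :
    ∃ Φ : Torus d → ℝ, Smooth Φ ∧ ∫ x, Φ x = 0 ∧ weightedLaplacian ρ Φ = σ := by
  set s : Torus d → ℝ := fun x => Real.sqrt (ρ x) with hs_def
  have hs : Smooth s := hρ.sqrt hpos
  have hs0 : ∀ x, 0 < s x := fun x => Real.sqrt_pos.2 (hpos x)
  have hne : ∀ x, s x ≠ 0 := fun x => (hs0 x).ne'
  have hss : s * s = ρ := funext fun x => Real.mul_self_sqrt (hpos x).le
  have hmass : 0 < ∫ x, ρ x := by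
    refine lt_of_le_of_ne (integral_nonneg fun x => (hpos x).le) fun h => ?_
    have := eq_zero_of_integral_eq_zero hρ.continuous (fun x => (hpos x).le) h.symm
    exact (hpos 0).ne' (congrFun this 0)
  have hq : Smooth (laplacian s / s) := (smooth_laplacian hs).div hs hne
  -- Undoing `u = s Φ` gives `Δ_ρ Φ = (∫ u) ρ + g s`. Integrating kills everything but `(∫ u) ∫ ρ`,
  -- so the rank one term vanishes by itself.
  have trans : ∀ (u g : Torus d → ℝ), Smooth u → Smooth g → ∫ x, g x * s x = 0 →
      laplacian u = laplacian s / s * u + (fun x => (∫ y, u y) * s x) + g →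
      Smooth (u / s) ∧ weightedLaplacian ρ (u / s) = g * s ∧ ∫ y, u y = 0 := by
    intro u g hu hg hgs h
    have hΦ : Smooth (u / s) := hu.div hs hne
    have hsΦ : s * (u / s) = u := by
      funext x; simp only [Pi.mul_apply, Pi.div_apply]; field_simp [hne x]
    have h1 : weightedLaplacian ρ (u / s) = (∫ y, u y) • ρ + g * s := by
      rw [← hss, weightedLaplacian_sq hs hΦ, hsΦ, h]
      funext x
      simp only [Pi.add_apply, Pi.sub_apply, Pi.mul_apply, Pi.div_apply, Pi.smul_apply,
        smul_eq_mul]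
      field_simp [hne x]
      ring
    have h2 := integral_weightedLaplacian hρ hΦ
    rw [h1, integral_add' (hρ.const_smul _).integrable (hg.mul hs).integrable] at h2
    simp only [Pi.smul_apply, Pi.mul_apply, hgs, add_zero, smul_eq_mul, integral_const_mul] at h2
    have h3 : ∫ y, u y = 0 := (mul_eq_zero.1 h2).resolve_right hmass.ne'
    exact ⟨hΦ, by rw [h1, h3, zero_smul, zero_add], h3⟩
  obtain ⟨u, hu, h⟩ := exists_schrodinger hq hs (hσ.div hs hne) fun u hu h => by
    obtain ⟨h1, h2, h3⟩ := trans u 0 hu (Smooth.const 0) (by simp) (by rw [h, add_zero])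
    obtain ⟨c, hc⟩ := exists_eq_const_of_weightedLaplacian_eq_zero hρ hpos h1
      (by rw [h2, zero_mul])
    -- The kernel is spanned by `s`, and `∫ u = 0` with `s > 0` excludes it.
    have hu' : u = fun x => c * s x := by
      funext x
      have := congrFun hc x
      rw [Pi.div_apply, div_eq_iff (hne x)] at this
      exact this
    rw [hu', integral_const_mul] at h3
    have hc0 : c = 0 := by
      refine (mul_eq_zero.1 h3).resolve_right fun h4 => ?_
      exact hne 0 (congrFun (eq_zero_of_integral_eq_zero hs.continuous
        (fun x => (hs0 x).le) h4) 0)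
    rw [hu', hc0]; funext x; simp
  have hσs : σ / s * s = σ := by
    funext x; simp only [Pi.mul_apply, Pi.div_apply]; field_simp [hne x]
  obtain ⟨h1, h2, -⟩ := trans u _ hu (hσ.div hs hne) (by
    have : ∀ x, (σ / s) x * s x = σ x := fun x => congrFun hσs x
    simp only [this, hσ0]) h
  refine ⟨u / s - fun _ => ∫ x, (u / s) x, h1.sub (Smooth.const _), ?_, ?_⟩
  · rw [integral_sub' h1.integrable (integrable_const _)]; simp
  · rw [weightedLaplacian_sub_right hρ h1 (Smooth.const _), h2, hσs]
    funext x
    have : weightedLaplacian ρ (fun _ => ∫ x, (u / s) x) x = 0 := by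
      rw [weightedLaplacian_apply]
      refine Finset.sum_eq_zero fun i _ => ?_
      rw [tderiv_const, mul_zero]
      exact congrFun (tderiv_const (0 : ℝ) i) x
    rw [Pi.sub_apply, this, sub_zero]

end Schrodinger

/-! ### First variations and perturbations of densities. -/

section Energy

variable {d : ℕ}

lemma Smooth.integrable_mul {f g : Torus d → ℝ} (hf : Smooth f) (hg : Smooth g) :
    Integrable (fun x => f x * g x) := (hf.mul hg).integrable

lemma IsTangent.sub {σ τ : Torus d → ℝ} (hσ : IsTangent σ) (hτ : IsTangent τ) :
    IsTangent (σ - τ) :=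
  ⟨Smooth.sub hσ.smooth hτ.smooth, by
    rw [integral_sub' (Smooth.integrable hσ.smooth) (Smooth.integrable hτ.smooth), hσ.mean_zero,
      hτ.mean_zero, sub_zero]⟩

lemma IsTangent.neg {σ : Torus d → ℝ} (hσ : IsTangent σ) : IsTangent (-σ) :=
  ⟨Smooth.neg hσ.smooth, by simp [integral_neg, hσ.mean_zero]⟩

lemma isTangent_weightedLaplacian {a f : Torus d → ℝ} (ha : Smooth a) (hf : Smooth f) :
    IsTangent (weightedLaplacian a f) :=
  ⟨smooth_weightedLaplacian ha hf, integral_weightedLaplacian ha hf⟩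

/-- Subtracting the mean does not change the pairing with mean-zero `σ`, so the normalised choice
exists and the default value `0` is not taken. -/
lemma firstVariation_spec {F : (Torus d → ℝ) → ℝ} {ρ : Torus d → ℝ}
    (h : ∃ φ, IsFirstVariation F ρ φ) :
    IsFirstVariation F ρ (firstVariation F ρ) ∧ ∫ x, firstVariation F ρ x = 0 := by
  have hex : ∃ φ : Torus d → ℝ, IsFirstVariation F ρ φ ∧ ∫ x, φ x = 0 := by
    obtain ⟨φ, hφ, hφ'⟩ := h
    have hsφ : Smooth φ := hφ
    refine ⟨φ - fun _ => ∫ x, φ x, ⟨hsφ.sub (Smooth.const _), fun σ hσ => ?_⟩, ?_⟩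
    · have hi : ∫ x, (φ - fun _ => ∫ y, φ y : Torus d → ℝ) x * σ x = ∫ x, φ x * σ x := by
        simp only [Pi.sub_apply, sub_mul]
        rw [integral_sub (hsφ.integrable_mul hσ.smooth)
          (((Smooth.integrable hσ.smooth)).const_mul _), integral_const_mul, hσ.mean_zero,
          mul_zero, sub_zero]
      rw [hi]
      exact hφ' σ hσ
    · rw [integral_sub' hsφ.integrable (integrable_const _)]; simp
  rw [firstVariation, dif_pos hex]
  exact hex.choose_spec

lemma integral_firstVariation_mul {F : (Torus d → ℝ) → ℝ} {ρ φ σ : Torus d → ℝ}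
    (h : IsFirstVariation F ρ φ) (hσ : IsTangent σ) :
    ∫ x, firstVariation F ρ x * σ x = ∫ x, φ x * σ x :=
  ((firstVariation_spec ⟨φ, h⟩).1.2 σ hσ).unique (h.2 σ hσ)

lemma exists_isDensity_add {ρ σ τ : Torus d → ℝ} (hρ : IsDensity ρ) (hσ : IsTangent σ)
    (hτ : IsTangent τ) :
    ∃ δ > 0, ∀ a b : ℝ, |a| < δ → |b| < δ → IsDensity (ρ + a • σ + b • τ) := by
  have hρs : Smooth ρ := hρ.smooth
  have hσs : Smooth σ := hσ.smooth
  have hτs : Smooth τ := hτ.smooth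
  obtain ⟨x₀, -, hx₀⟩ := isCompact_univ.exists_isMinOn (univ_nonempty (α := Torus d))
    hρs.continuous.continuousOn
  obtain ⟨C, hC⟩ := isCompact_univ.exists_bound_of_continuousOn (s := (univ : Set (Torus d)))
    hσs.continuous.continuousOn
  obtain ⟨D, hD⟩ := isCompact_univ.exists_bound_of_continuousOn (s := (univ : Set (Torus d)))
    hτs.continuous.continuousOn
  have hc := hρ.pos x₀
  have hC0 : 0 ≤ C := (norm_nonneg _).trans (hC x₀ trivial)
  have hD0 : 0 ≤ D := (norm_nonneg _).trans (hD x₀ trivial)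
  -- `ρ x₀` is the minimum of `ρ`, and `C`, `D` bound `|σ|`, `|τ|`; the perturbation then stays
  -- below `ρ x₀`.
  refine ⟨ρ x₀ / (C + D + 1), by positivity, fun a b ha hb =>
    ⟨(hρs.add (hσs.const_smul a)).add (hτs.const_smul b), fun x => ?_, ?_⟩⟩
  · have h1 : |a * σ x| ≤ ρ x₀ / (C + D + 1) * C := by
      rw [abs_mul]
      exact mul_le_mul ha.le (hC x trivial) (abs_nonneg _) (by positivity)
    have h2 : |b * τ x| ≤ ρ x₀ / (C + D + 1) * D := by
      rw [abs_mul]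
      exact mul_le_mul hb.le (hD x trivial) (abs_nonneg _) (by positivity)
    have h3 : ρ x₀ / (C + D + 1) * C + ρ x₀ / (C + D + 1) * D < ρ x₀ := by
      rw [← mul_add, div_mul_eq_mul_div, div_lt_iff₀ (by positivity)]
      nlinarith
    have h4 : ρ x₀ ≤ ρ x := hx₀ (mem_univ x)
    simp only [Pi.add_apply, Pi.smul_apply, smul_eq_mul]
    linarith [neg_abs_le (a * σ x), neg_abs_le (b * τ x)]
  · rw [integral_add' (hρs.add (hσs.const_smul a)).integrable (hτs.const_smul b).integrable,
      integral_add' hρs.integrable (hσs.const_smul a).integrable]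
    simp [integral_const_mul, hρ.mass, hσ.mean_zero, hτ.mean_zero]

/-! ### Second variation, Christoffel symbol and linearity of the Hessian metric. -/

variable {E : (Torus d → ℝ) → ℝ}

lemma IsSmoothEnergy.firstVariation_spec (hE : IsSmoothEnergy E) {ρ : Torus d → ℝ}
    (hρ : IsDensity ρ) :
    IsFirstVariation E ρ (firstVariation E ρ) ∧ ∫ x, firstVariation E ρ x = 0 :=
  TransportHessian.firstVariation_spec (hE.exists_firstVariation ρ hρ)

lemma IsSmoothEnergy.smooth_fv (hE : IsSmoothEnergy E) {ρ : Torus d → ℝ} (hρ : IsDensity ρ) :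
    Smooth (firstVariation E ρ) := (hE.firstVariation_spec hρ).1.1

/-- The first variation is smooth along a line of densities. -/
lemma IsSmoothEnergy.smoothFam_firstVariation (hE : IsSmoothEnergy E) {ρ σ : Torus d → ℝ}
    (hρ : IsDensity ρ) (hσ : IsTangent σ) :
    ∃ δ > 0, (∀ a : ℝ, a ∈ Ioo (-δ) δ → IsDensity (ρ + a • σ)) ∧
      SmoothFam (Ioo (-δ) δ) (fun a => firstVariation E (ρ + a • σ)) := by
  obtain ⟨δ, hδ, h⟩ := exists_isDensity_add hρ hσ hσ
  have hd : ∀ a : ℝ, a ∈ Ioo (-δ) δ → IsDensity (ρ + a • σ) := fun a ha => by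
    simpa using h a 0 (abs_lt.2 ha) (by simpa using hδ)
  refine ⟨δ, hδ, hd, ?_⟩
  have hr : IsSmoothFamily {s : Fin 1 → ℝ | s 0 ∈ Ioo (-δ) δ} (fun s => ρ + s 0 • σ) := by
    refine ContDiff.contDiffOn ?_
    have h1 : ContDiff ℝ ∞ (fun p : (Fin 1 → ℝ) × (Fin d → ℝ) => ρ (proj p.2)) :=
      ContDiff.comp (g := fun y : Fin d → ℝ => ρ (proj y)) hρ.smooth contDiff_snd
    have h2 : ContDiff ℝ ∞ (fun p : (Fin 1 → ℝ) × (Fin d → ℝ) => σ (proj p.2)) :=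
      ContDiff.comp (g := fun y : Fin d → ℝ => σ (proj y)) hσ.smooth contDiff_snd
    have h3 : ContDiff ℝ ∞ (fun p : (Fin 1 → ℝ) × (Fin d → ℝ) => p.1 0) := by fun_prop
    exact h1.add (h3.mul h2)
  have h1 := hE.smooth_firstVariation 1 _ _ (isOpen_Ioo.preimage (continuous_apply 0)) hr
    fun s hs => hd _ hs
  have h2 : ContDiff ℝ ∞ (fun p : ℝ × (Fin d → ℝ) => ((fun _ => p.1 : Fin 1 → ℝ), p.2)) := by
    fun_prop
  exact ContDiffOn.comp h1 h2.contDiffOn fun p hp => ⟨hp.1, trivial⟩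

/-- The derivative of the first variation in the direction `σ`. -/
def varDeriv (E : (Torus d → ℝ) → ℝ) (ρ σ : Torus d → ℝ) : Torus d → ℝ :=
  paramDeriv (fun a : ℝ => firstVariation E (ρ + a • σ)) 0

lemma IsSmoothEnergy.smooth_varDeriv (hE : IsSmoothEnergy E) {ρ σ : Torus d → ℝ}
    (hρ : IsDensity ρ) (hσ : IsTangent σ) : Smooth (varDeriv E ρ σ) := by
  obtain ⟨δ, hδ, -, h⟩ := hE.smoothFam_firstVariation hρ hσ
  exact (h.paramDeriv isOpen_Ioo).slice ⟨neg_lt_zero.2 hδ, hδ⟩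

/-- The inner derivative is the pairing of `δE` with `τ`; the outer one passes under the integral.
Linearity in `τ` becomes visible. -/
lemma IsSmoothEnergy.secondVariation_eq (hE : IsSmoothEnergy E) {ρ σ τ : Torus d → ℝ}
    (hρ : IsDensity ρ) (hσ : IsTangent σ) (hτ : IsTangent τ) :
    secondVariation E ρ σ τ = ∫ x, varDeriv E ρ σ x * τ x := by
  obtain ⟨δ, hδ, hd, h⟩ := hE.smoothFam_firstVariation hρ hσ
  have h0 : (0 : ℝ) ∈ Ioo (-δ) δ := ⟨neg_lt_zero.2 hδ, hδ⟩
  have h1 : (fun a : ℝ => deriv (fun b : ℝ => E (ρ + a • σ + b • τ)) 0) =ᶠ[𝓝 0]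
      fun a => ∫ x, firstVariation E (ρ + a • σ) x * τ x := by
    filter_upwards [isOpen_Ioo.mem_nhds h0] with a ha
    exact ((hE.firstVariation_spec (hd a ha)).1.2 τ hτ).deriv
  rw [secondVariation, h1.deriv_eq]
  have h2 := (h.mul (SmoothFam.of_smooth hτ.smooth)).hasDerivAt_integral isOpen_Ioo h0
  refine h2.deriv.trans (integral_congr_ae (ae_of_all _ fun x => ?_))
  exact ((h.hasDerivAt isOpen_Ioo h0 x).mul_const (τ x)).deriv

lemma deriv_deriv_comm {H : ℝ × ℝ → ℝ} (hc : ContDiffAt ℝ ∞ H (0, 0)) :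
    deriv (fun a => deriv (fun b => H (a, b)) 0) 0 =
      deriv (fun b => deriv (fun a => H (a, b)) 0) 0 := by
  have hd : DifferentiableAt ℝ (fderiv ℝ H) (0, 0) :=
    (hc.fderiv_right (m := 1) (by norm_cast)).differentiableAt (by simp)
  have hev : ∀ᶠ p in 𝓝 ((0 : ℝ), (0 : ℝ)), DifferentiableAt ℝ H p := by
    filter_upwards [(hc.of_le (m := 1) (by norm_cast)).eventually (by simp)] with p hp
    exact hp.differentiableAt (by simp)
  have hl : ∀ s : ℝ, HasDerivAt (fun a : ℝ => (a, (0 : ℝ))) (1, 0) s := fun s =>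
    (hasDerivAt_id s).prodMk (hasDerivAt_const s 0)
  have hr : ∀ s : ℝ, HasDerivAt (fun b : ℝ => ((0 : ℝ), b)) (0, 1) s := fun s =>
    (hasDerivAt_const s 0).prodMk (hasDerivAt_id s)
  have e1 : (fun a => deriv (fun b => H (a, b)) 0) =ᶠ[𝓝 0] fun a => fderiv ℝ H (a, 0) (0, 1) := by
    have ht : Tendsto (fun a : ℝ => (a, (0 : ℝ))) (𝓝 0) (𝓝 (0, 0)) :=
      (hl 0).continuousAt
    filter_upwards [ht.eventually hev] with a ha
    exact (ha.hasFDerivAt.comp_hasDerivAt (0 : ℝ)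
      ((hasDerivAt_const (0 : ℝ) a).prodMk (hasDerivAt_id 0))).deriv
  have e2 : (fun b => deriv (fun a => H (a, b)) 0) =ᶠ[𝓝 0] fun b => fderiv ℝ H (0, b) (1, 0) := by
    have ht : Tendsto (fun b : ℝ => ((0 : ℝ), b)) (𝓝 0) (𝓝 (0, 0)) :=
      (hr 0).continuousAt
    filter_upwards [ht.eventually hev] with b hb
    exact (hb.hasFDerivAt.comp_hasDerivAt (0 : ℝ)
      ((hasDerivAt_id (0 : ℝ)).prodMk (hasDerivAt_const 0 b))).deriv
  have h1 : HasDerivAt (fun a => fderiv ℝ H (a, 0) (0, 1))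
      (fderiv ℝ (fderiv ℝ H) (0, 0) (1, 0) (0, 1)) 0 := by
    simpa using (HasFDerivAt.comp_hasDerivAt (x := (0 : ℝ)) (f := fun a : ℝ => (a, (0 : ℝ)))
      hd.hasFDerivAt (hl 0)).clm_apply
      (hasDerivAt_const (0 : ℝ) ((0 : ℝ), (1 : ℝ)))
  have h2 : HasDerivAt (fun b => fderiv ℝ H (0, b) (1, 0))
      (fderiv ℝ (fderiv ℝ H) (0, 0) (0, 1) (1, 0)) 0 := by
    simpa using (HasFDerivAt.comp_hasDerivAt (x := (0 : ℝ)) (f := fun b : ℝ => ((0 : ℝ), b))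
      hd.hasFDerivAt (hr 0)).clm_apply
      (hasDerivAt_const (0 : ℝ) ((1 : ℝ), (0 : ℝ)))
  rw [e1.deriv_eq, e2.deriv_eq, h1.deriv, h2.deriv]
  exact hc.isSymmSndFDerivAt
    (by simpa using (WithTop.coe_le_coe.2 le_top : ((2 : ℕ∞) : WithTop ℕ∞) ≤ ∞)) _ _

/-- Symmetry comes from smoothness of `E` on two-parameter families. It lets `σ ↦ δ²E(σ, v)` be
written as integration against a function. -/
lemma IsSmoothEnergy.secondVariation_comm (hE : IsSmoothEnergy E) {ρ σ τ : Torus d → ℝ}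
    (hρ : IsDensity ρ) (hσ : IsTangent σ) (hτ : IsTangent τ) :
    secondVariation E ρ σ τ = secondVariation E ρ τ σ := by
  obtain ⟨δ, hδ, hd⟩ := exists_isDensity_add hρ hσ hτ
  set U : Set (Fin 2 → ℝ) := {s | |s 0| < δ} ∩ {s | |s 1| < δ} with hU
  have hUo : IsOpen U := by
    refine IsOpen.inter ?_ ?_ <;> exact isOpen_lt (by fun_prop) continuous_const
  have hr : IsSmoothFamily U (fun s => ρ + s 0 • σ + s 1 • τ) := by
    refine ContDiff.contDiffOn ?_
    have h0 : ∀ f : Torus d → ℝ, Smooth f →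
        ContDiff ℝ ∞ (fun p : (Fin 2 → ℝ) × (Fin d → ℝ) => f (proj p.2)) := fun f hf =>
      ContDiff.comp (g := fun y : Fin d → ℝ => f (proj y)) hf contDiff_snd
    have h3 : ∀ i, ContDiff ℝ ∞ (fun p : (Fin 2 → ℝ) × (Fin d → ℝ) => p.1 i) := fun i => by
      fun_prop
    exact ((h0 ρ hρ.smooth).add ((h3 0).mul (h0 σ hσ.smooth))).add ((h3 1).mul (h0 τ hτ.smooth))
  have h1 := hE.smooth 2 U _ hUo hr fun s hs => hd _ _ hs.1 hs.2
  have h2 : ContDiffAt ℝ ∞ (fun s : Fin 2 → ℝ => E (ρ + s 0 • σ + s 1 • τ)) ![0, 0] :=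
    h1.contDiffAt (hUo.mem_nhds ⟨by simpa using hδ, by simpa using hδ⟩)
  have h3 : ContDiff ℝ ∞ (fun p : ℝ × ℝ => (![p.1, p.2] : Fin 2 → ℝ)) := by
    refine contDiff_pi.2 fun i => ?_
    fin_cases i
    · exact contDiff_fst
    · exact contDiff_snd
  have h4 := deriv_deriv_comm (H := fun p : ℝ × ℝ => E (ρ + p.1 • σ + p.2 • τ))
    (ContDiffAt.comp (g := fun s : Fin 2 → ℝ => E (ρ + s 0 • σ + s 1 • τ))
      ((0 : ℝ), (0 : ℝ)) h2 h3.contDiffAt)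
  refine h4.trans ?_
  simp only [secondVariation, add_right_comm ρ]

/-- Elliptic solvability guarantees that `Δ_ρ⁻¹` is a true inverse on tangent vectors and not the
default `0`. -/
lemma invWeightedLaplacian_spec {ρ σ : Torus d → ℝ} (hρ : IsDensity ρ) (hσ : IsTangent σ) :
    Smooth (invWeightedLaplacian ρ σ) ∧ ∫ x, invWeightedLaplacian ρ σ x = 0 ∧
      weightedLaplacian ρ (invWeightedLaplacian ρ σ) = σ := by
  obtain ⟨Φ, h1, h2, h3⟩ :=
    exists_weightedLaplacian_eq hρ.smooth hρ.pos hσ.smooth hσ.mean_zero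
  rw [invWeightedLaplacian_eq hρ h1 h2 h3]
  exact ⟨h1, h2, h3⟩

lemma invWeightedLaplacian_sub {ρ σ τ : Torus d → ℝ} (hρ : IsDensity ρ) (hσ : IsTangent σ)
    (hτ : IsTangent τ) :
    invWeightedLaplacian ρ (σ - τ) = invWeightedLaplacian ρ σ - invWeightedLaplacian ρ τ := by
  obtain ⟨h1, h2, h3⟩ := invWeightedLaplacian_spec hρ hσ
  obtain ⟨k1, k2, k3⟩ := invWeightedLaplacian_spec hρ hτ
  refine invWeightedLaplacian_eq hρ (h1.sub k1) ?_ ?_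
  · rw [integral_sub' h1.integrable k1.integrable, h2, k2, sub_zero]
  · rw [weightedLaplacian_sub_right hρ.smooth h1 k1, h3, k3]

lemma smooth_christoffel {ρ σ τ : Torus d → ℝ} (hρ : IsDensity ρ) (hσ : IsTangent σ)
    (hτ : IsTangent τ) : Smooth (christoffel ρ σ τ) := by
  obtain ⟨h1, -, -⟩ := invWeightedLaplacian_spec hρ hσ
  obtain ⟨k1, -, -⟩ := invWeightedLaplacian_spec hρ hτ
  exact (((smooth_weightedLaplacian hσ.smooth k1).add
    (smooth_weightedLaplacian hτ.smooth h1)).add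
    (smooth_weightedLaplacian hρ.smooth (smooth_gradInner h1 k1))).const_smul (-(1 / 2))

lemma christoffel_sub {ρ σ τ υ : Torus d → ℝ} (hρ : IsDensity ρ) (hσ : IsTangent σ)
    (hτ : IsTangent τ) (hυ : IsTangent υ) :
    christoffel ρ σ (τ - υ) = christoffel ρ σ τ - christoffel ρ σ υ := by
  obtain ⟨h1, -, -⟩ := invWeightedLaplacian_spec hρ hσ
  obtain ⟨k1, -, -⟩ := invWeightedLaplacian_spec hρ hτ
  obtain ⟨l1, -, -⟩ := invWeightedLaplacian_spec hρ hυ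
  funext x
  simp only [christoffel, Pi.sub_apply]
  rw [invWeightedLaplacian_sub hρ hτ hυ, weightedLaplacian_sub_right hσ.smooth k1 l1,
    weightedLaplacian_sub_left hτ.smooth hυ.smooth h1, gradInner_sub_right k1 l1,
    weightedLaplacian_sub_right hρ.smooth (smooth_gradInner h1 k1) (smooth_gradInner h1 l1)]
  simp only [Pi.sub_apply]
  ring

lemma IsSmoothEnergy.hessianMetric_sub (hE : IsSmoothEnergy E) {ρ σ τ υ : Torus d → ℝ}
    (hρ : IsDensity ρ) (hσ : IsTangent σ) (hτ : IsTangent τ) (hυ : IsTangent υ) :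
    hessianMetric E ρ σ (τ - υ) = hessianMetric E ρ σ τ - hessianMetric E ρ σ υ := by
  have he := hE.smooth_fv hρ
  have hψ := hE.smooth_varDeriv hρ hσ
  simp only [hessianMetric]
  rw [hE.secondVariation_eq hρ hσ hτ, hE.secondVariation_eq hρ hσ hυ,
    hE.secondVariation_eq hρ hσ (hτ.sub hυ), christoffel_sub hρ hσ hτ hυ]
  simp only [Pi.sub_apply, mul_sub]
  rw [integral_sub (hψ.integrable_mul hτ.smooth) (hψ.integrable_mul hυ.smooth),
    integral_sub (he.integrable_mul (smooth_christoffel hρ hσ hτ))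
      (he.integrable_mul (smooth_christoffel hρ hσ hυ))]
  ring

/-! ### The derivative of `F` and the two gradients. -/

/-- The Wasserstein gradient direction `-∇·(ρ∇δE(ρ))`. -/
def transportGrad (E : (Torus d → ℝ) → ℝ) (ρ : Torus d → ℝ) : Torus d → ℝ :=
  -weightedLaplacian ρ (firstVariation E ρ)

lemma IsSmoothEnergy.isTangent_transportGrad (hE : IsSmoothEnergy E) {ρ : Torus d → ℝ}
    (hρ : IsDensity ρ) : IsTangent (transportGrad E ρ) :=
  (isTangent_weightedLaplacian hρ.smooth (hE.smooth_fv hρ)).neg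

/-- Exact equality, not merely up to a constant, because `δE(ρ)` is normalised to mean zero. -/
lemma IsSmoothEnergy.invWeightedLaplacian_transportGrad (hE : IsSmoothEnergy E)
    {ρ : Torus d → ℝ} (hρ : IsDensity ρ) :
    invWeightedLaplacian ρ (transportGrad E ρ) = -firstVariation E ρ := by
  have he := hE.smooth_fv hρ
  refine invWeightedLaplacian_eq hρ he.neg ?_ (weightedLaplacian_neg_right hρ.smooth he)
  simp [integral_neg, (hE.firstVariation_spec hρ).2]

/-- Product rule under the integral: the two equal gradient factors cancel the `½`, and varying the
weight `ρ` gives the second term. -/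
lemma IsSmoothEnergy.hasDerivAt_gradientEnergy (hE : IsSmoothEnergy E) {ρ σ : Torus d → ℝ}
    (hρ : IsDensity ρ) (hσ : IsTangent σ) :
    HasDerivAt (fun ε : ℝ => gradientEnergy E (ρ + ε • σ))
      ((∫ x, ρ x * gradInner (firstVariation E ρ) (varDeriv E ρ σ) x) +
        (1 / 2) * ∫ x, gradInner (firstVariation E ρ) (firstVariation E ρ) x * σ x) 0 := by
  obtain ⟨δ, hδ, hd, h⟩ := hE.smoothFam_firstVariation hρ hσ
  have h0 : (0 : ℝ) ∈ Ioo (-δ) δ := ⟨neg_lt_zero.2 hδ, hδ⟩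
  have he := hE.smooth_fv hρ
  have hψ := hE.smooth_varDeriv hρ hσ
  have hlin : SmoothFam (Ioo (-δ) δ) (fun a : ℝ => ρ + a • σ) :=
    (SmoothFam.of_smooth (f := ρ) hρ.smooth).add
      (ContDiff.contDiffOn (contDiff_fst.mul
        (ContDiff.comp (g := fun y : Fin d → ℝ => σ (proj y)) hσ.smooth contDiff_snd)))
  have hK : SmoothFam (Ioo (-δ) δ) (fun a : ℝ => gradInner (firstVariation E (ρ + a • σ))
      (firstVariation E (ρ + a • σ)) * (ρ + a • σ)) :=
    (SmoothFam.sum (s := Finset.univ) fun i _ =>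
      (h.tderiv isOpen_Ioo i).mul (h.tderiv isOpen_Ioo i)).mul hlin
  have hI := (hK.hasDerivAt_integral isOpen_Ioo h0).const_mul (1 / 2)
  refine hI.congr_deriv ?_
  have hpt : ∀ x, paramDeriv (fun a : ℝ => gradInner (firstVariation E (ρ + a • σ))
      (firstVariation E (ρ + a • σ)) * (ρ + a • σ)) 0 x =
      2 * (ρ x * gradInner (firstVariation E ρ) (varDeriv E ρ σ) x) +
        gradInner (firstVariation E ρ) (firstVariation E ρ) x * σ x := by
    intro x
    have h1 : ∀ i, HasDerivAt (fun a : ℝ => tderiv i (firstVariation E (ρ + a • σ)) x)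
        (tderiv i (varDeriv E ρ σ) x) 0 := by
      intro i
      have := (h.tderiv isOpen_Ioo i).hasDerivAt isOpen_Ioo h0 x
      rwa [h.paramDeriv_tderiv isOpen_Ioo h0 i] at this
    have h2 : HasDerivAt (fun a : ℝ => ρ x + a * σ x) (σ x) 0 := by
      simpa using ((hasDerivAt_id (0 : ℝ)).mul_const (σ x)).const_add (ρ x)
    have h3 := (HasDerivAt.fun_sum (u := Finset.univ) fun i _ => (h1 i).mul (h1 i)).mul h2
    refine h3.deriv.trans ?_
    simp only [zero_smul, add_zero, zero_mul, gradInner, pderiv_eq, Finset.sum_mul, Finset.mul_sum,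
      ← Finset.sum_add_distrib, Pi.mul_apply]
    refine Finset.sum_congr rfl fun i _ => ?_
    ring
  simp only [hpt]
  rw [integral_add (Smooth.integrable_mul hρ.smooth (smooth_gradInner he hψ) |>.const_mul 2)
    ((smooth_gradInner he he).integrable_mul hσ.smooth), integral_const_mul]
  ring

lemma IsSmoothEnergy.integral_gradInner_varDeriv (hE : IsSmoothEnergy E) {ρ σ : Torus d → ℝ}
    (hρ : IsDensity ρ) (hσ : IsTangent σ) :
    ∫ x, ρ x * gradInner (firstVariation E ρ) (varDeriv E ρ σ) x =
      secondVariation E ρ σ (transportGrad E ρ) := by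
  have h1 := integral_weightedLaplacian_mul hρ.smooth (hE.smooth_fv hρ) (hE.smooth_varDeriv hρ hσ)
  rw [hE.secondVariation_eq hρ hσ (hE.isTangent_transportGrad hρ)]
  simp only [transportGrad, Pi.neg_apply, mul_neg, integral_neg]
  rw [← neg_eq_iff_eq_neg.2 h1]
  simp only [mul_comm]

/-- In `δ²E(σ, v)` the direction `σ` sits inside `varDeriv`; symmetry moves it out, leaving the
density `varDeriv E ρ v`. -/
lemma IsSmoothEnergy.isFirstVariation_gradientEnergy (hE : IsSmoothEnergy E) {ρ : Torus d → ℝ}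
    (hρ : IsDensity ρ) :
    IsFirstVariation (gradientEnergy E) ρ (varDeriv E ρ (transportGrad E ρ) +
      (1 / 2 : ℝ) • gradInner (firstVariation E ρ) (firstVariation E ρ)) := by
  have he := hE.smooth_fv hρ
  have hv := hE.isTangent_transportGrad hρ
  have hψ := hE.smooth_varDeriv hρ hv
  have hg := smooth_gradInner he he
  refine ⟨hψ.add (hg.const_smul _), fun σ hσ => ?_⟩
  refine (hE.hasDerivAt_gradientEnergy hρ hσ).congr_deriv ?_
  rw [hE.integral_gradInner_varDeriv hρ hσ, hE.secondVariation_comm hρ hσ hv,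
    hE.secondVariation_eq hρ hv hσ]
  simp only [Pi.add_apply, Pi.smul_apply, smul_eq_mul, add_mul, mul_assoc]
  rw [integral_add (hψ.integrable_mul hσ.smooth) ((hg.integrable_mul hσ.smooth).const_mul _),
    integral_const_mul]

/-- With `Δ_ρ⁻¹ v = -e`, the `Δ_σ` term gives the right-hand side. The other two produce `½ ∫ v (∇Φ,
∇e)` and, moving `Δ_ρ` onto `e` where `Δ_ρ e = -v`, its negative. -/
lemma IsSmoothEnergy.integral_mul_christoffel (hE : IsSmoothEnergy E) {ρ σ : Torus d → ℝ}
    (hρ : IsDensity ρ) (hσ : IsTangent σ) :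
    ∫ x, firstVariation E ρ x * christoffel ρ σ (transportGrad E ρ) x =
      -((1 / 2) * ∫ x, gradInner (firstVariation E ρ) (firstVariation E ρ) x * σ x) := by
  set e := firstVariation E ρ with he_def
  set v := transportGrad E ρ with hv_def
  set Φ := invWeightedLaplacian ρ σ with hΦ_def
  have he : Smooth e := hE.smooth_fv hρ
  have hv : IsTangent v := hE.isTangent_transportGrad hρ
  have hΦ : Smooth Φ := (invWeightedLaplacian_spec hρ hσ).1
  have hg : Smooth (gradInner Φ e) := smooth_gradInner hΦ he
  have h1 : ∀ x, e x * christoffel ρ σ v x =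
      (1 / 2) * (weightedLaplacian σ e x * e x) - (1 / 2) * (weightedLaplacian v Φ x * e x) +
        (1 / 2) * (weightedLaplacian ρ (gradInner Φ e) x * e x) := by
    intro x
    simp only [christoffel]
    rw [hv_def, hE.invWeightedLaplacian_transportGrad hρ, ← hv_def, ← he_def, ← hΦ_def,
      weightedLaplacian_neg_right hσ.smooth he, gradInner_neg_right he,
      weightedLaplacian_neg_right hρ.smooth hg]
    simp only [Pi.neg_apply]
    ring
  have i1 := ((smooth_weightedLaplacian hσ.smooth he).integrable_mul he).const_mul (1 / 2)
  have i2 := ((smooth_weightedLaplacian hv.smooth hΦ).integrable_mul he).const_mul (1 / 2)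
  have i3 := ((smooth_weightedLaplacian hρ.smooth hg).integrable_mul he).const_mul (1 / 2)
  simp only [h1]
  refine (integral_add (i1.sub i2) i3).trans ?_
  rw [integral_sub' i1 i2]
  simp only [integral_const_mul]
  have h2 : ∫ x, gradInner Φ e x * weightedLaplacian ρ e x = -∫ x, v x * gradInner Φ e x := by
    rw [← integral_neg]
    refine integral_congr_ae (ae_of_all _ fun x => ?_)
    simp only [hv_def, transportGrad, Pi.neg_apply, ← he_def]
    ring
  rw [integral_weightedLaplacian_mul hσ.smooth he he, integral_weightedLaplacian_mul hv.smooth hΦ he,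
    integral_weightedLaplacian_mul_comm hρ.smooth hg he, h2]
  simp only [mul_comm (gradInner e e _)]
  ring

lemma IsSmoothEnergy.hessianMetric_transportGrad (hE : IsSmoothEnergy E) {ρ σ : Torus d → ℝ}
    (hρ : IsDensity ρ) (hσ : IsTangent σ) :
    hessianMetric E ρ σ (transportGrad E ρ) =
      ∫ x, firstVariation (gradientEnergy E) ρ x * σ x := by
  have hF := hE.isFirstVariation_gradientEnergy hρ
  rw [integral_firstVariation_mul hF hσ,
    (hF.2 σ hσ).unique (hE.hasDerivAt_gradientEnergy hρ hσ),
    hE.integral_gradInner_varDeriv hρ hσ, hessianMetric, hE.integral_mul_christoffel hρ hσ,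
    sub_neg_eq_add]

lemma IsSmoothEnergy.isGradient_hessianMetric_iff (hE : IsSmoothEnergy E) {ρ : Torus d → ℝ}
    (hρ : IsDensity ρ)
    (hpos : ∀ σ : Torus d → ℝ, IsTangent σ → σ ≠ 0 → 0 < hessianMetric E ρ σ σ)
    (v : Torus d → ℝ) :
    IsGradient (hessianMetric E) (gradientEnergy E) ρ v ↔ v = transportGrad E ρ := by
  have hg := hE.isTangent_transportGrad hρ
  constructor
  · rintro ⟨hv, -, h⟩
    have hw := hv.sub hg
    by_contra hne
    -- Two gradients have the same pairings, so their difference `w` satisfies `g^H(w, w) = 0`.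
    refine (hpos _ hw (sub_ne_zero.2 hne)).ne' ?_
    rw [hE.hessianMetric_sub hρ hw hv hg, h _ hw, hE.hessianMetric_transportGrad hρ hw, sub_self]
  · rintro rfl
    exact ⟨hg, ⟨_, hE.isFirstVariation_gradientEnergy hρ⟩,
      fun σ hσ => hE.hessianMetric_transportGrad hρ hσ⟩

lemma IsSmoothEnergy.isGradient_transportMetric_iff (hE : IsSmoothEnergy E) {ρ : Torus d → ℝ}
    (hρ : IsDensity ρ) (v : Torus d → ℝ) :
    IsGradient transportMetric E ρ v ↔ v = transportGrad E ρ := by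
  have he := hE.smooth_fv hρ
  constructor
  · rintro ⟨hv, -, h⟩
    obtain ⟨h1, h2, h3⟩ := invWeightedLaplacian_spec hρ hv
    set Φ := invWeightedLaplacian ρ v with hΦ
    have hs : Smooth (Φ + firstVariation E ρ) := h1.add he
    -- `Φ + e` has mean zero and is an admissible test vector; the gradient equation then reads `∫
    -- (Φ + e)² = 0`.
    have hσ : IsTangent (Φ + firstVariation E ρ) := ⟨hs, by
      rw [integral_add' h1.integrable he.integrable, h2, (hE.firstVariation_spec hρ).2, add_zero]⟩
    have h4 := h _ hσ
    rw [transportMetric, ← hΦ, ← sub_eq_zero] at h4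
    simp only [← Pi.neg_apply Φ] at h4
    rw [← integral_sub (hs.integrable_mul h1.neg) (he.integrable_mul hs)] at h4
    have h5 : ∫ x, (Φ + firstVariation E ρ) x * (Φ + firstVariation E ρ) x = 0 := by
      rw [← neg_eq_zero, ← integral_neg, ← h4]
      refine integral_congr_ae (ae_of_all _ fun x => ?_)
      simp only [Pi.add_apply, Pi.neg_apply]; ring
    have h6 := eq_zero_of_integral_eq_zero (hs.mul hs).continuous
      (fun x => mul_self_nonneg _) h5
    have h7 : Φ = -firstVariation E ρ := by
      funext x
      have := mul_self_eq_zero.1 (congrFun h6 x)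
      simp only [Pi.add_apply] at this
      simp only [Pi.neg_apply]; linarith
    rw [← h3, h7, weightedLaplacian_neg_right hρ.smooth he, transportGrad]
  · rintro rfl
    refine ⟨hE.isTangent_transportGrad hρ, hE.exists_firstVariation ρ hρ, fun σ hσ => ?_⟩
    rw [transportMetric, hE.invWeightedLaplacian_transportGrad hρ]
    simp only [Pi.neg_apply, neg_neg, mul_comm]

lemma isGradientFlow_iff {G : (Torus d → ℝ) → (Torus d → ℝ) → (Torus d → ℝ) → ℝ}
    {F : (Torus d → ℝ) → ℝ}
    (h : ∀ ρ, IsDensity ρ → ∀ v, IsGradient G F ρ v ↔ v = transportGrad E ρ)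
    (I : Set ℝ) (ρ : ℝ → Torus d → ℝ) :
    IsGradientFlow G F I ρ ↔ SolvesTransportEquation E I ρ := by
  refine and_congr_right fun hρ => forall₂_congr fun t ht => ?_
  simp only [h _ (hρ t ht), exists_eq_left, transportGrad, Pi.neg_apply, neg_neg]

end Energy

end TransportHessian

end

theorem mainTheorem6 {d : ℕ}
    (E : (TransportHessian.Torus d → ℝ) → ℝ)
    (hE : TransportHessian.IsSmoothEnergy E)
    (hpos : ∀ ρ : TransportHessian.Torus d → ℝ, TransportHessian.IsDensity ρ →
      ∀ σ : TransportHessian.Torus d → ℝ, TransportHessian.IsTangent σ → σ ≠ 0 →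
        0 < TransportHessian.hessianMetric E ρ σ σ) :
    (∀ ρ : TransportHessian.Torus d → ℝ, TransportHessian.IsDensity ρ →
      ∀ v : TransportHessian.Torus d → ℝ,
        (TransportHessian.IsGradient (TransportHessian.hessianMetric E)
            (TransportHessian.gradientEnergy E) ρ v ↔
          v = -TransportHessian.weightedLaplacian ρ (TransportHessian.firstVariation E ρ)) ∧
        (TransportHessian.IsGradient TransportHessian.transportMetric E ρ v ↔
          v = -TransportHessian.weightedLaplacian ρ (TransportHessian.firstVariation E ρ))) ∧
    (∀ (I : Set ℝ) (ρ : ℝ → TransportHessian.Torus d → ℝ),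
      (TransportHessian.IsGradientFlow (TransportHessian.hessianMetric E)
          (TransportHessian.gradientEnergy E) I ρ ↔
        TransportHessian.SolvesTransportEquation E I ρ) ∧
      (TransportHessian.IsGradientFlow TransportHessian.transportMetric E I ρ ↔
        TransportHessian.SolvesTransportEquation E I ρ)) := by
  have hH := fun ρ (hρ : TransportHessian.IsDensity ρ) =>
    hE.isGradient_hessianMetric_iff hρ (hpos ρ hρ)
  have hT := fun ρ (hρ : TransportHessian.IsDensity ρ) => hE.isGradient_transportMetric_iff hρ
  exact ⟨fun ρ hρ v => ⟨hH ρ hρ v, hT ρ hρ v⟩, fun I ρ =>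
    ⟨TransportHessian.isGradientFlow_iff hH I ρ, TransportHessian.isGradientFlow_iff hT I ρ⟩⟩
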